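/- Identify finite binary strings with natural numbers through the enumeration $\langle\rangle,0,1,00,01,10,11,000,\dots$ of $2^{<\omega}$ (by length, then lexicographically). A *tree code* is a $Z\in 2^{\omega}$ for which $T_Z=\{\sigma\in 2^{<\omega}: Z(\sigma)=1\}$ is closed under initial segments; it codes the closed set $[T_Z]\subseteq 2^{\omega}$ of paths through $T_Z$, which is called *nontrivial* if $T_Z$ is infinite. For $s\ge 0$, $n\in\omega$ and a finite binary string $\nu$, let $m$ be the largest integer with $|\nu|\ge 2^{m+1}-1$ (if $\nu\neq\langle\rangle$). If $\nu\ne\langle\rangle$ and $m\ge n$, let $\tilde H^s_n(\nu)$ be the minimum of $\sum_{\sigma\in V}2^{-s|\sigma|}$ over all $V\subseteq 2^{<\omega}$ such that $n\le|\sigma|\le m$ for all $\sigma\in V$, and every $\sigma$ with $|\sigma|=m$ and $\nu(\sigma)=1$ has an initial segment in $V$; otherwise let $\tilde H^s_n(\nu)=2^{(1-s)n}$. For a tree code $Z$ put $H^s_n(Z)=\lim_{k\to\infty}\tilde H^s_n(Z\upharpoonright k)$. **Theorem.** Let $Z_F\in 2^{\omega}$ be a tree code of a nontrivial closed set $F\subseteq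 2^\omega$, and let $c\ge 0$ and $s>0$ be computable real numbers such that $$c\le\lim_{n\to\infty}H^s_n(Z_F)\in[0,\infty].$$ Then there is a tree code $Z_E\in 2^{\omega}$ of a nontrivial closed set $E\subseteq F$ such that $Z_E\le_T Z_F'$, where $Z_F'$ is the Turing jump of $Z_F$, and $$\lim_{n\to\infty}H^s_n(Z_E)=c.$$ -/

import Mathlib

open Filter Topology

/-! ### Strings, tree codes and closed sets in Cantor space -/

namespace CantorSpace

/-- The position of a binary string in the enumeration `⟨⟩, 0, 1, 00, 01, 10, 11, 000, …` of
`2^{<ω}`, first by length and then lexicographically.  It identifies strings with numbers. -/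
def strIndex (σ : List Bool) : ℕ :=
  σ.foldl (fun a b => 2 * a + 1 + b.toNat) 0

/-- The initial segment of length `k` of an element of `2^ω`. -/
def restrict (Z : ℕ → Bool) (k : ℕ) : List Bool :=
  (List.range k).map Z

/-- The set of strings coded by `Z`: all `σ` with `Z(σ) = 1`. -/
def codedTree (Z : ℕ → Bool) : Set (List Bool) :=
  {σ | Z (strIndex σ) = true}

/-- `Z` is a tree code: the coded set of strings is closed under initial segments. -/
def IsTreeCode (Z : ℕ → Bool) : Prop :=
  ∀ σ τ : List Bool, σ ∈ codedTree Z → τ <+: σ → τ ∈ codedTree Z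

/-- The closed set of paths through the tree coded by `Z`. -/
def closedSet (Z : ℕ → Bool) : Set (ℕ → Bool) :=
  {X | ∀ n : ℕ, restrict X n ∈ codedTree Z}

/-- A coded closed set is called nontrivial if its tree is infinite. -/
def IsNontrivial (Z : ℕ → Bool) : Prop :=
  (codedTree Z).Infinite

/-! ### Hausdorff premeasures of tree codes -/

/-- The `s`-weight `W_s(V) = ∑_{σ ∈ V} 2^{-s|σ|}`. -/
noncomputable def weight (s : ℝ) (V : Finset (List Bool)) : ℝ :=
  ∑ σ ∈ V, (2 : ℝ) ^ (-(s * (σ.length : ℝ)))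

/-- The sets `V` of strings over which the minimum in the definition of `preH` is taken: all
lengths lie between `n` and `m`, and every `σ` of length `m` with `ν(σ) = 1` has an initial segment
in `V`.  (Such a `V` is automatically finite.) -/
def IsCover (n m : ℕ) (ν : List Bool) (V : Finset (List Bool)) : Prop :=
  (∀ σ ∈ V, n ≤ σ.length ∧ σ.length ≤ m) ∧
    ∀ σ : List Bool, σ.length = m → ν[strIndex σ]? = some true → ∃ τ ∈ V, τ <+: σ

/-- The function `H̃^s_n` on finite strings `ν`.  For `ν` nonempty, the largest `m` with
`2^(m+1) - 1 ≤ |ν|` is `m = Nat.log 2 (|ν| + 1) - 1`; hence the condition of the first case says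
that `ν` is nonempty and `n ≤ m`.  The infimum there is a minimum, see `exists_isCover_weight_eq`. -/
noncomputable def preH (s : ℝ) (n : ℕ) (ν : List Bool) : ℝ :=
  if n + 1 ≤ Nat.log 2 (ν.length + 1) then
    sInf {w : ℝ | ∃ V : Finset (List Bool),
      IsCover n (Nat.log 2 (ν.length + 1) - 1) ν V ∧ w = weight s V}
  else (2 : ℝ) ^ ((1 - s) * (n : ℝ))

/-- `H^s_n(Z) = lim_k H̃^s_n(Z ↾ k)`.  The limit exists for every tree code `Z`, see `tendsto_H`. -/
noncomputable def H (s : ℝ) (n : ℕ) (Z : ℕ → Bool) : ℝ :=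
  limUnder atTop (fun k : ℕ => preH s n (restrict Z k))

/-- All strings of length `n`. -/
def strings (n : ℕ) : Finset (List Bool) :=
  Finset.univ.image (List.Vector.toList : List.Vector Bool n → List Bool)

theorem mem_strings {n : ℕ} {σ : List Bool} : σ ∈ strings n ↔ σ.length = n := by
  constructor
  · intro h
    obtain ⟨v, -, rfl⟩ := Finset.mem_image.1 h
    exact v.2
  · intro h
    exact Finset.mem_image.2 ⟨⟨σ, h⟩, Finset.mem_univ _, rfl⟩

theorem weight_strings (s : ℝ) (n : ℕ) :
    weight s (strings n) = (2 : ℝ) ^ ((1 - s) * (n : ℝ)) := by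
  have h1 : weight s (strings n) = ∑ _σ ∈ strings n, (2 : ℝ) ^ (-(s * (n : ℝ))) :=
    Finset.sum_congr rfl fun σ hσ => by rw [mem_strings.1 hσ]
  have h2 : (strings n).card = 2 ^ n := by
    unfold strings
    rw [Finset.card_image_of_injective _ (fun a b h => List.Vector.toList_injective h)]
    simp
  rw [h1, Finset.sum_const, h2, nsmul_eq_mul, Nat.cast_pow, Nat.cast_ofNat, ← Real.rpow_natCast,
    ← Real.rpow_add two_pos]
  congr 1
  ring

theorem isCover_strings {n m : ℕ} (h : n ≤ m) (ν : List Bool) : IsCover n m ν (strings n) := by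
  refine ⟨fun σ hσ => by rw [mem_strings.1 hσ]; exact ⟨le_rfl, h⟩, fun σ hσ _ => ?_⟩
  exact ⟨σ.take n, mem_strings.2 (by rw [List.length_take]; omega), List.take_prefix _ _⟩

theorem weight_nonneg (s : ℝ) (V : Finset (List Bool)) : 0 ≤ weight s V :=
  Finset.sum_nonneg fun _ _ => by positivity

theorem exists_isCover_weight_eq (s : ℝ) {n : ℕ} {ν : List Bool}
    (h : n + 1 ≤ Nat.log 2 (ν.length + 1)) :
    ∃ V, IsCover n (Nat.log 2 (ν.length + 1) - 1) ν V ∧ preH s n ν = weight s V := by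
  set m := Nat.log 2 (ν.length + 1) - 1 with hm
  have hfin : {w : ℝ | ∃ V, IsCover n m ν V ∧ w = weight s V}.Finite := by
    refine (((Finset.range (m + 1)).biUnion strings).powerset.finite_toSet.image
      (weight s)).subset ?_
    rintro w ⟨V, hV, rfl⟩
    refine ⟨V, Finset.mem_coe.2 (Finset.mem_powerset.2 fun σ hσ => ?_), rfl⟩
    exact Finset.mem_biUnion.2
      ⟨σ.length, Finset.mem_range.2 (Nat.lt_succ_of_le (hV.1 σ hσ).2), mem_strings.2 rfl⟩
  have hne : {w : ℝ | ∃ V, IsCover n m ν V ∧ w = weight s V}.Nonempty :=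
    ⟨_, strings n, isCover_strings (by omega) ν, rfl⟩
  obtain ⟨V, hV, hw⟩ := hne.csInf_mem hfin
  exact ⟨V, hV, by rw [preH, if_pos h]; exact hw⟩

theorem preH_le (s : ℝ) {n : ℕ} {ν : List Bool} (h : n + 1 ≤ Nat.log 2 (ν.length + 1))
    {V : Finset (List Bool)} (hV : IsCover n (Nat.log 2 (ν.length + 1) - 1) ν V) :
    preH s n ν ≤ weight s V := by
  rw [preH, if_pos h]
  exact csInf_le ⟨0, by rintro w ⟨V, -, rfl⟩; exact weight_nonneg s V⟩ ⟨V, hV, rfl⟩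

theorem preH_nonneg (s : ℝ) (n : ℕ) (ν : List Bool) : 0 ≤ preH s n ν := by
  by_cases h : n + 1 ≤ Nat.log 2 (ν.length + 1)
  · obtain ⟨V, -, hV⟩ := exists_isCover_weight_eq s h
    exact hV ▸ weight_nonneg s V
  · rw [preH, if_neg h]
    positivity

theorem strIndex_lt (σ : List Bool) : strIndex σ + 1 < 2 ^ (σ.length + 1) := by
  have key : ∀ (l : List Bool) (a : ℕ),
      l.foldl (fun a b => 2 * a + 1 + b.toNat) a + 2 ≤ 2 ^ l.length * (a + 2) := by
    intro l
    induction l with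
    | nil => intro a; simp
    | cons b l ih =>
      intro a
      refine (ih _).trans ?_
      rw [List.length_cons, pow_succ, mul_assoc]
      refine Nat.mul_le_mul_left _ ?_
      have := Bool.toNat_le b
      show 2 * a + 1 + b.toNat + 2 ≤ 2 * (a + 2)
      omega
  have := key σ 0
  rw [pow_succ]
  unfold strIndex
  omega

theorem restrict_getElem? {Z : ℕ → Bool} {k : ℕ} {σ : List Bool} :
    (restrict Z k)[strIndex σ]? = some true ↔ strIndex σ < k ∧ σ ∈ codedTree Z := by
  simp only [restrict, List.getElem?_map, codedTree, Set.mem_ofPred_eq]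
  by_cases h : strIndex σ < k
  · simp [h]
  · simp [h]

theorem preH_antitone (s : ℝ) (n : ℕ) {Z : ℕ → Bool} (hZ : IsTreeCode Z) :
    Antitone fun k : ℕ => preH s n (restrict Z k) := by
  intro k l hkl
  have hlen : ∀ j, (restrict Z j).length = j := fun j => by simp [restrict]
  have hlog : Nat.log 2 (k + 1) ≤ Nat.log 2 (l + 1) := Nat.log_mono_right (by omega)
  show preH s n (restrict Z l) ≤ preH s n (restrict Z k)
  by_cases hl : n + 1 ≤ Nat.log 2 (l + 1)
  · by_cases hk : n + 1 ≤ Nat.log 2 (k + 1)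
    · obtain ⟨V, hV, hVw⟩ := exists_isCover_weight_eq s (ν := restrict Z k) (by rwa [hlen])
      rw [hVw]
      refine preH_le s (by rwa [hlen]) ?_
      rw [hlen] at hV ⊢
      refine ⟨fun σ hσ => ⟨(hV.1 σ hσ).1, (hV.1 σ hσ).2.trans (by omega)⟩, fun σ hσ hσZ => ?_⟩
      set m := Nat.log 2 (k + 1) - 1 with hm
      have hlenm : (σ.take m).length = m := by rw [List.length_take]; omega
      obtain ⟨τ, hτ, hτσ⟩ := hV.2 (σ.take m) hlenm (restrict_getElem?.2
        ⟨by
          have h1 := strIndex_lt (σ.take m)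
          have h2 : 2 ^ Nat.log 2 (k + 1) ≤ k + 1 := Nat.pow_log_le_self 2 (by omega)
          rw [hlenm, show m + 1 = Nat.log 2 (k + 1) by omega] at h1
          omega,
        hZ _ _ (restrict_getElem?.1 hσZ).2 (List.take_prefix _ _)⟩)
      exact ⟨τ, hτ, hτσ.trans (List.take_prefix _ _)⟩
    · rw [preH.eq_1 s n (restrict Z k), if_neg (by rwa [hlen]), ← weight_strings]
      exact preH_le s (by rwa [hlen]) (isCover_strings (by rw [hlen]; omega) _)
  · rw [preH, preH, if_neg (by rwa [hlen]), if_neg (by rw [hlen]; omega)]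

/-- The limit defining `H^s_n(Z)` exists for every tree code `Z`. -/
theorem tendsto_H (s : ℝ) (n : ℕ) {Z : ℕ → Bool} (hZ : IsTreeCode Z) :
    Tendsto (fun k : ℕ => preH s n (restrict Z k)) atTop (𝓝 (H s n Z)) :=
  tendsto_nhds_limUnder ⟨_, tendsto_atTop_ciInf (preH_antitone s n hZ)
    ⟨0, by rintro _ ⟨k, rfl⟩; exact preH_nonneg s n _⟩⟩

/-! ### Computable reals and the Turing jump -/

/-- A real `x` is computable if there is a computable sequence of rationals
`q_n = (a_n - b_n) / (d_n + 1)` with `|x - q_n| ≤ 2^{-n}` for all `n`. -/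
def IsComputableReal (x : ℝ) : Prop :=
  ∃ a b d : ℕ → ℕ, Computable a ∧ Computable b ∧ Computable d ∧
    ∀ n : ℕ, |x - ((a n : ℝ) - (b n : ℝ)) / ((d n : ℝ) + 1)| ≤ ((2 : ℝ) ^ n)⁻¹

/-- An element of `2^ω` as a total `0`-`1`-valued function, in the form used for oracles. -/
def charFn (Z : ℕ → Bool) : ℕ →. ℕ :=
  fun n => Part.some (Z n).toNat

/-- Programs with an oracle, one constructor for each clause of `Nat.RecursiveIn`. -/
inductive OracleCode : Type
  | zero : OracleCode
  | succ : OracleCode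
  | left : OracleCode
  | right : OracleCode
  | oracle : OracleCode
  | pair : OracleCode → OracleCode → OracleCode
  | comp : OracleCode → OracleCode → OracleCode
  | prec : OracleCode → OracleCode → OracleCode
  | rfind : OracleCode → OracleCode

namespace OracleCode

/-- The partial function computed by a program with oracle `g`. -/
def eval (g : ℕ →. ℕ) : OracleCode → ℕ →. ℕ
  | zero => fun _ => Part.some 0
  | succ => fun n => Part.some (n + 1)
  | left => fun n => Part.some n.unpair.1
  | right => fun n => Part.some n.unpair.2
  | oracle => g
  | pair c d => fun n => Nat.pair <$> eval g c n <*> eval g d n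
  | comp c d => fun n => eval g d n >>= eval g c
  | prec c d => fun p =>
      p.unpair.2.rec (eval g c p.unpair.1) fun y ih => do
        let i ← ih
        eval g d (Nat.pair p.unpair.1 (Nat.pair y i))
  | rfind c => fun a => Nat.rfind fun n => (fun m => m = 0) <$> eval g c (Nat.pair a n)

/-- The Gödel number of a program. -/
def godel : OracleCode → ℕ
  | zero => 0
  | succ => 1
  | left => 2
  | right => 3
  | oracle => 4
  | pair c d => 4 * Nat.pair (godel c) (godel d) + 5
  | comp c d => 4 * Nat.pair (godel c) (godel d) + 6
  | prec c d => 4 * Nat.pair (godel c) (godel d) + 7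
  | rfind c => 4 * godel c + 8

/-- The Gödel numbering is a bijection, so that every number is the index of exactly one program. -/
theorem godel_bijective : Function.Bijective godel := by
  constructor
  · intro c
    induction c with
    | zero | succ | left | right | oracle =>
      intro d h
      cases d <;> simp only [godel] at h <;> first | rfl | omega
    | pair a b iha ihb | comp a b iha ihb | prec a b iha ihb =>
      intro d h
      cases d <;> simp only [godel] at h <;> try omega
      rename_i a' b'
      have h' : Nat.pair (godel a) (godel b) = Nat.pair (godel a') (godel b') := by omega
      obtain ⟨h1, h2⟩ := Nat.pair_eq_pair.1 h'
      rw [iha h1, ihb h2]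
    | rfind a iha =>
      intro d h
      cases d <;> simp only [godel] at h <;> try omega
      rename_i a'
      rw [iha (show godel a = godel a' by omega)]
  · intro e
    induction e using Nat.strong_induction_on with
    | _ e ih =>
      by_cases h0 : e < 5
      · interval_cases e
        exacts [⟨zero, rfl⟩, ⟨succ, rfl⟩, ⟨left, rfl⟩, ⟨right, rfl⟩, ⟨oracle, rfl⟩]
      · set q := (e - 5) / 4 with hq
        have hqe : q < e := by omega
        obtain ⟨c, hc⟩ := ih q.unpair.1 ((Nat.unpair_left_le q).trans_lt hqe)
        obtain ⟨d, hd⟩ := ih q.unpair.2 ((Nat.unpair_right_le q).trans_lt hqe)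
        obtain ⟨r, hr⟩ := ih q hqe
        have hp : Nat.pair (godel c) (godel d) = q := by rw [hc, hd, Nat.pair_unpair]
        have h4 : (e - 5) % 4 < 4 := Nat.mod_lt _ (by omega)
        have : e = 4 * q + 5 ∨ e = 4 * q + 6 ∨ e = 4 * q + 7 ∨ e = 4 * q + 8 := by omega
        rcases this with h | h | h | h
        · exact ⟨pair c d, by rw [godel, hp, h]⟩
        · exact ⟨comp c d, by rw [godel, hp, h]⟩
        · exact ⟨prec c d, by rw [godel, hp, h]⟩
        · exact ⟨rfind r, by rw [godel, hr, h]⟩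

/-- The programs compute exactly the functions that are partial recursive in the oracle. -/
theorem exists_eval_iff (g f : ℕ →. ℕ) : (∃ c, eval g c = f) ↔ Nat.RecursiveIn {g} f := by
  constructor
  · rintro ⟨c, rfl⟩
    induction c with
    | zero => exact .zero
    | succ => exact .succ
    | left => exact .left
    | right => exact .right
    | oracle => exact .oracle g rfl
    | pair c d hc hd => exact .pair hc hd
    | comp c d hc hd => exact .comp hc hd
    | prec c d hc hd => exact .prec hc hd
    | rfind c hc => exact .rfind hc
  · intro h
    induction h with
    | zero => exact ⟨zero, rfl⟩
    | succ => exact ⟨succ, rfl⟩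
    | left => exact ⟨left, rfl⟩
    | right => exact ⟨right, rfl⟩
    | oracle g' hg => exact ⟨oracle, hg.symm⟩
    | pair _ _ hc hd =>
      obtain ⟨c, rfl⟩ := hc
      obtain ⟨d, rfl⟩ := hd
      exact ⟨pair c d, rfl⟩
    | comp _ _ hc hd =>
      obtain ⟨c, rfl⟩ := hc
      obtain ⟨d, rfl⟩ := hd
      exact ⟨comp c d, rfl⟩
    | prec _ _ hc hd =>
      obtain ⟨c, rfl⟩ := hc
      obtain ⟨d, rfl⟩ := hd
      exact ⟨prec c d, rfl⟩
    | rfind _ hc =>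
      obtain ⟨c, rfl⟩ := hc
      exact ⟨rfind c, rfl⟩

end OracleCode

open Classical in
/-- The Turing jump `Z' = {e : φ_e^Z(e)↓}`, where `φ_e^Z` is computed with oracle `Z` by the program
with Gödel number `e`. -/
noncomputable def turingJump (Z : ℕ → Bool) : ℕ → Bool :=
  fun e => decide (∃ c : OracleCode, c.godel = e ∧ (c.eval (charFn Z) e).Dom)

end CantorSpace

/-!
If `c` is the limit of the premeasures of `F` itself, one takes `E = F`.  Otherwise fix a computable
sequence of rationals `q k` that decreases to `c`, and a number `m` with `q m ≤ H s m Z_F`.  The tree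
`E` comes from a greedy version of the Besicovitch construction of subsets of finite measure.
Strings of `F` are examined in order of length, and a string with accepted predecessor is accepted,
except that at sparse levels `J * (k + 1)`, `m ≤ k`, it must not violate two conditions: what remains
of `F` above the strings accepted at this level has a cover by strings longer than `k` of weight less
than `q k`, and in each cylinder of level `k` it has such a cover of weight less than that of the
cylinder (`IsGreedySubtree`).

The first condition gives `H s (k + 1) Z_E ≤ q k`.  For the lower bound there are two steps.  Since
a single string of level `J * (k + 1)` has very small weight, rejecting strings only when forced to
keeps the covers of the remaining set by strings of length at least `k` at weight `q k` or more
(`IsGreedySubtree.not_hasLightCover_succ`).  And the second condition allows one to replace, in a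
cover of `E`, every short string by longer ones without increasing the weight, until that lower bound
applies (`IsGreedySubtree.exists_covers_longer`); compactness enters only in that a cover of `E`
already covers one of the finite stages of the construction.

As for effectivity, both conditions are strict upper bounds for infima over finite covers, hence
recursively enumerable in `Z_F` for computable `s` and `q` (`greedyCheck`), so that the jump of `Z_F`
decides them.  The code of `E` is obtained by course-of-values recursion from these decisions
(`exists_turingReducible_turingJump`).
-/

namespace CantorSpace

/-! ### Recursion relative to an oracle and to its jump -/

section Oracle

variable {O : Set (ℕ →. ℕ)}

theorem computableIn_comp {f g : ℕ → ℕ} (hf : ComputableIn O f) (hg : ComputableIn O g) :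
    ComputableIn O fun n => f (g n) := by
  have hf' := RecursiveIn.iff_nat.1 hf
  have hg' := RecursiveIn.iff_nat.1 hg
  exact RecursiveIn.iff_nat.2 ((hf'.comp hg').of_eq fun n => by simp)

theorem computableIn_pair {f g : ℕ → ℕ} (hf : ComputableIn O f) (hg : ComputableIn O g) :
    ComputableIn O fun n => Nat.pair (f n) (g n) := by
  have hf' := RecursiveIn.iff_nat.1 hf
  have hg' := RecursiveIn.iff_nat.1 hg
  exact RecursiveIn.iff_nat.2 ((hf'.pair hg').of_eq fun n => by simp [Seq.seq])

theorem computableIn_rec {g : ℕ → ℕ} (a : ℕ) (hg : ComputableIn O g) :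
    ComputableIn O fun n => Nat.rec (motive := fun _ => ℕ) a (fun y i => g (Nat.pair y i)) n := by
  have hr : Primrec fun n : ℕ => n.unpair.2 := Primrec.snd.comp Primrec.unpair
  have hg' := RecursiveIn.iff_nat.1 (computableIn_comp hg hr.computableIn)
  have ha := RecursiveIn.iff_nat.1 (ComputableIn.const (O := O) (α := ℕ) a)
  have h0 : Primrec fun n : ℕ => Nat.pair 0 n :=
    Primrec₂.natPair.comp (Primrec.const 0) Primrec.id
  have h0' := RecursiveIn.iff_nat.1 (h0.computableIn (O := O))
  refine RecursiveIn.iff_nat.2 (((ha.prec hg').comp h0').of_eq fun n => ?_)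
  simp only [Part.bind_eq_bind, Part.bind_some, Nat.unpair_pair]
  induction n with
  | zero => rfl
  | succ n ih => simp only [ih, Part.bind_some]

/-- The code of the string obtained by appending one bit to a coded string. -/
def appendBit (i b : ℕ) : ℕ :=
  Encodable.encode (((Encodable.decode i : Option (List Bool)).getD []) ++ [decide (b = 1)])

theorem appendBit_encode (l : List Bool) (b : Bool) :
    appendBit (Encodable.encode l) b.toNat = Encodable.encode (l ++ [b]) := by
  cases b <;> simp [appendBit]

theorem primrec_appendBit : Primrec₂ appendBit := by
  refine Primrec.encode.comp (Primrec.list_append.comp ?_ ?_)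
  · exact Primrec.option_getD.comp (Primrec.decode.comp Primrec.fst) (Primrec.const [])
  · refine Primrec.list_cons.comp ?_ (Primrec.const [])
    exact (Primrec.eq.comp Primrec.snd (Primrec.const 1)).decide

theorem restrict_succ (Z : ℕ → Bool) (k : ℕ) : restrict Z (k + 1) = restrict Z k ++ [Z k] := by
  simp [restrict, List.range_succ]

theorem length_restrict (Z : ℕ → Bool) (k : ℕ) : (restrict Z k).length = k := by
  simp [restrict]

theorem computableIn_charFn (Z : ℕ → Bool) :
    ComputableIn {charFn Z} fun n => (Z n).toNat :=
  RecursiveIn.iff_nat.2 (.oracle _ rfl)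

theorem computableIn_restrict (Z : ℕ → Bool) :
    ComputableIn {charFn Z} fun k => Encodable.encode (restrict Z k) := by
  have h1 : Primrec fun n : ℕ => n.unpair.1 := Primrec.fst.comp Primrec.unpair
  have h2 : Primrec fun n : ℕ => n.unpair.2 := Primrec.snd.comp Primrec.unpair
  have happ : Primrec fun n : ℕ => appendBit n.unpair.1 n.unpair.2 :=
    primrec_appendBit.comp h1 h2
  have hg := computableIn_comp (happ.computableIn (O := {charFn Z}))
    (computableIn_pair h2.computableIn
      (computableIn_comp (computableIn_charFn Z) h1.computableIn))
  have := computableIn_rec (Encodable.encode ([] : List Bool)) hg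
  simp only [Nat.unpair_pair] at this
  convert this using 2 with k
  induction k with
  | zero => rfl
  | succ k ih =>
    rw [restrict_succ, ← appendBit_encode, ih]

/-- A program that ignores its input and returns `n`. -/
def OracleCode.const : ℕ → OracleCode
  | 0 => .zero
  | n + 1 => .comp .succ (OracleCode.const n)

theorem OracleCode.eval_const (g : ℕ →. ℕ) (n x : ℕ) :
    (OracleCode.const n).eval g x = Part.some n := by
  induction n with
  | zero => rfl
  | succ n ih => simp [OracleCode.const, OracleCode.eval, ih]

theorem OracleCode.primrec_godel_const : Primrec fun n => (OracleCode.const n).godel := by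
  have h : Primrec fun n : ℕ =>
      Nat.rec (motive := fun _ => ℕ) 0 (fun _ i => 4 * Nat.pair 1 i + 6) n := by
    refine Primrec.nat_rec₁ 0 ?_
    exact Primrec.nat_add.comp (Primrec.nat_mul.comp (Primrec.const 4)
      (Primrec₂.natPair.comp (Primrec.const 1) Primrec.snd)) (Primrec.const 6)
  refine h.of_eq fun n => ?_
  induction n with
  | zero => rfl
  | succ n ih => simp only [OracleCode.const, OracleCode.godel, ih]

/-- The domain of a function that is partial recursive in `Z` is decidable in the jump of `Z`:
the instance `n` of the domain problem is the halting problem for the program that ignores its input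
and runs on `n`. -/
theorem exists_primrec_turingJump_iff {Z : ℕ → Bool} {f : ℕ →. ℕ}
    (hf : Nat.RecursiveIn {charFn Z} f) :
    ∃ e : ℕ → ℕ, Primrec e ∧ ∀ n, turingJump Z (e n) = true ↔ (f n).Dom := by
  obtain ⟨c, rfl⟩ := (OracleCode.exists_eval_iff _ _).2 hf
  refine ⟨fun n => (OracleCode.comp c (OracleCode.const n)).godel, ?_, fun n => ?_⟩
  · exact Primrec.nat_add.comp (Primrec.nat_mul.comp (Primrec.const 4)
      (Primrec₂.natPair.comp (Primrec.const c.godel) OracleCode.primrec_godel_const))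
      (Primrec.const 6)
  · have key : ∀ x, (OracleCode.comp c (OracleCode.const n)).eval (charFn Z) x =
        c.eval (charFn Z) n := fun x => by
      simp only [OracleCode.eval, OracleCode.eval_const]
      exact Part.bind_some _ _
    simp only [turingJump, decide_eq_true_eq]
    constructor
    · rintro ⟨d, hd, hdom⟩
      rw [OracleCode.godel_bijective.1 hd, key] at hdom
      exact hdom
    · intro h
      exact ⟨_, rfl, by rwa [key]⟩

/-- A predicate on strings that is recursively enumerable in `Z` is decidable in the jump
of `Z`. -/
theorem exists_primrec_turingJump_iff_exists {Z : ℕ → Bool} {R : List Bool → ℕ → List Bool → Bool}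
    (hR : Computable fun x : List Bool × ℕ × List Bool => R x.1 x.2.1 x.2.2) :
    ∃ e : ℕ → ℕ, Primrec e ∧ ∀ ν : List Bool,
      turingJump Z (e (Encodable.encode ν)) = true ↔ ∃ k w, R ν w (restrict Z k) = true := by
  have h1 : Primrec fun n : ℕ => n.unpair.1 := Primrec.fst.comp Primrec.unpair
  have h2 : Primrec fun n : ℕ => n.unpair.2 := Primrec.snd.comp Primrec.unpair
  have hdec : Primrec fun n : ℕ => (Encodable.decode n : Option (List Bool)).getD [] :=
    Primrec.option_getD.comp Primrec.decode (Primrec.const [])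
  let φ : ℕ → ℕ := fun n => (! R ((Encodable.decode n.unpair.1.unpair.1).getD [])
    n.unpair.1.unpair.2.unpair.2 ((Encodable.decode n.unpair.2).getD [])).toNat
  have hφ : Computable φ := by
    have hin : Primrec fun n : ℕ =>
        (((Encodable.decode n.unpair.1.unpair.1 : Option (List Bool)).getD [],
          n.unpair.1.unpair.2.unpair.2,
          (Encodable.decode n.unpair.2 : Option (List Bool)).getD []) :
          List Bool × ℕ × List Bool) :=
      Primrec.pair (hdec.comp (h1.comp h1))
        (Primrec.pair (h2.comp (h2.comp h1)) (hdec.comp h2))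
    exact (Primrec.dom_bool fun b => (!b).toNat).to_comp.comp (hR.comp hin.to_comp)
  have hψ := computableIn_comp (hφ.computableIn (O := {charFn Z}))
    (computableIn_pair (Primrec.id.computableIn)
      (computableIn_comp (computableIn_restrict Z) (h1.comp h2).computableIn))
  obtain ⟨e, he, hd⟩ := exists_primrec_turingJump_iff (RecursiveIn.iff_nat.1 hψ).rfind
  refine ⟨e, he, fun ν => (hd _).trans ?_⟩
  have hval : ∀ n, φ (Nat.pair (Nat.pair (Encodable.encode ν) n)
      (Encodable.encode (restrict Z n.unpair.1))) = (! R ν n.unpair.2 (restrict Z n.unpair.1)).toNat :=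
    fun n => by simp [φ]
  refine Nat.rfind_dom'.trans ?_
  constructor
  · rintro ⟨n, hn, -⟩
    refine ⟨n.unpair.1, n.unpair.2, ?_⟩
    simpa [hval] using hn
  · rintro ⟨k, w, h⟩
    refine ⟨Nat.pair k w, ?_, fun _ => ?_⟩
    · have := hval (Nat.pair k w)
      simp only [Nat.unpair_pair, h] at this
      simpa using this
    · simp

/-- Course-of-values recursion along a predicate that is recursively enumerable in `Z`: the
characteristic function produced by deciding the predicate on its own initial segments is
recursive in the jump of `Z`. -/
theorem exists_turingReducible_turingJump {Z : ℕ → Bool} {R : List Bool → ℕ → List Bool → Bool}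
    (hR : Computable fun x : List Bool × ℕ × List Bool => R x.1 x.2.1 x.2.2) :
    ∃ Y : ℕ → Bool, TuringReducible (charFn Y) (charFn (turingJump Z)) ∧
      ∀ n, Y n = true ↔ ∃ k w, R (restrict Y n) w (restrict Z k) = true := by
  obtain ⟨e, he, hd⟩ := exists_primrec_turingJump_iff_exists (Z := Z) hR
  let W : List Bool → Bool := fun ν => turingJump Z (e (Encodable.encode ν))
  let L : ℕ → List Bool := fun n =>
    Nat.rec (motive := fun _ => List Bool) [] (fun _ l => l ++ [W l]) n
  have hL : ∀ n, L n = restrict (fun k => W (L k)) n := by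
    intro n
    induction n with
    | zero => rfl
    | succ n ih => rw [restrict_succ, ← ih]
  refine ⟨fun n => W (L n), ?_, fun n => ?_⟩
  · have h2 : Primrec fun n : ℕ => n.unpair.2 := Primrec.snd.comp Primrec.unpair
    have happ : Primrec fun n : ℕ => appendBit n.unpair.1 n.unpair.2 :=
      primrec_appendBit.comp (Primrec.fst.comp Primrec.unpair) h2
    have hW := computableIn_comp (computableIn_charFn (turingJump Z)) he.computableIn
    have hg := computableIn_comp happ.computableIn
      (computableIn_pair h2.computableIn (computableIn_comp hW h2.computableIn))
    have hrec := computableIn_rec (Encodable.encode ([] : List Bool)) hg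
    have hcode : ∀ n, Nat.rec (motive := fun _ => ℕ) (Encodable.encode ([] : List Bool))
        (fun y i => appendBit (Nat.pair (Nat.pair y i).unpair.2
          (turingJump Z (e (Nat.pair y i).unpair.2)).toNat).unpair.1
          (Nat.pair (Nat.pair y i).unpair.2
          (turingJump Z (e (Nat.pair y i).unpair.2)).toNat).unpair.2) n
        = Encodable.encode (L n) := by
      intro n
      induction n with
      | zero => rfl
      | succ n ih =>
        simp only [Nat.unpair_pair] at ih ⊢
        rw [ih]
        exact appendBit_encode _ _
    have := computableIn_comp hW hrec
    simp only [hcode] at this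
    exact this
  · show W (L n) = true ↔ _
    rw [hL n]
    exact hd _

end Oracle

/-! ### Strings and their indices -/

theorem strIndex_append_singleton (σ : List Bool) (b : Bool) :
    strIndex (σ ++ [b]) = 2 * strIndex σ + 1 + b.toNat := by
  simp [strIndex]

theorem strIndex_injective : Function.Injective strIndex := by
  intro σ
  induction σ using List.reverseRecOn with
  | nil =>
    intro τ h
    rcases List.eq_nil_or_concat' τ with rfl | ⟨ρ, b, rfl⟩
    · rfl
    · rw [strIndex_append_singleton, show strIndex [] = 0 from rfl] at h
      omega
  | append_singleton σ a ih =>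
    intro τ h
    rcases List.eq_nil_or_concat' τ with rfl | ⟨ρ, b, rfl⟩
    · rw [strIndex_append_singleton] at h
      simp [strIndex] at h
    · rw [strIndex_append_singleton, strIndex_append_singleton] at h
      have ha := Bool.toNat_le a
      have hb := Bool.toNat_le b
      have h1 : strIndex σ = strIndex ρ := by omega
      have h2 : a.toNat = b.toNat := by omega
      rw [ih h1]
      cases a <;> cases b <;> simp_all

theorem strIndex_surjective : Function.Surjective strIndex := by
  intro n
  induction n using Nat.strong_induction_on with
  | _ n ih =>
    rcases Nat.eq_zero_or_pos n with rfl | hn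
    · exact ⟨[], rfl⟩
    · obtain ⟨σ, hσ⟩ := ih ((n - 1) / 2) (by omega)
      refine ⟨σ ++ [decide ((n - 1) % 2 = 1)], ?_⟩
      rw [strIndex_append_singleton, hσ]
      by_cases h : (n - 1) % 2 = 1
      · simp only [h, decide_true, Bool.toNat_true]
        omega
      · simp only [h, decide_false, Bool.toNat_false]
        omega

theorem card_strings (n : ℕ) : (strings n).card = 2 ^ n := by
  unfold strings
  rw [Finset.card_image_of_injective _ (fun a b h => List.Vector.toList_injective h)]
  simp

theorem take_eq_of_prefix {σ τ : List Bool} {n : ℕ} (h : σ <+: τ) (hn : n ≤ σ.length) :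
    τ.take n = σ.take n := by
  obtain ⟨ρ, rfl⟩ := h
  exact List.take_append_of_le_length hn

/-! ### Covers of sets of strings -/

/-- Every sufficiently long string of `T` has an initial segment in `V`.  For a tree `T` this says
that the cylinders given by `V` cover the set of paths through `T`. -/
def Covers (T : Set (List Bool)) (V : Finset (List Bool)) : Prop :=
  ∃ N, ∀ σ ∈ T, N ≤ σ.length → ∃ v ∈ V, v <+: σ

/-- The paths through `T` can be covered by cylinders of length at least `n` of total `s`-weight
less than `θ`.  For the tree coded by `Z` this says that `H s n Z < θ`, see `H_lt_iff`. -/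
def HasLightCover (s : ℝ) (n : ℕ) (T : Set (List Bool)) (θ : ℝ) : Prop :=
  ∃ V : Finset (List Bool), (∀ v ∈ V, n ≤ v.length) ∧ Covers T V ∧ weight s V < θ

/-- The strings of `T` that extend `τ`. -/
def extensions (T : Set (List Bool)) (τ : List Bool) : Set (List Bool) :=
  {σ | σ ∈ T ∧ τ <+: σ}

theorem Covers.of_long {T T' : Set (List Bool)} {V : Finset (List Bool)} (h : Covers T' V) (N : ℕ)
    (hT : ∀ σ ∈ T, N ≤ σ.length → σ ∈ T') : Covers T V := by
  obtain ⟨M, hM⟩ := h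
  refine ⟨max M N, fun σ hσ hl => ?_⟩
  exact hM σ (hT σ hσ (le_of_max_le_right hl)) (le_of_max_le_left hl)

theorem HasLightCover.of_long {s : ℝ} {n : ℕ} {T T' : Set (List Bool)} {θ : ℝ}
    (h : HasLightCover s n T' θ) (N : ℕ) (hT : ∀ σ ∈ T, N ≤ σ.length → σ ∈ T') :
    HasLightCover s n T θ := by
  obtain ⟨V, h1, h2, h3⟩ := h
  exact ⟨V, h1, h2.of_long N hT, h3⟩

theorem HasLightCover.of_isEmpty {s : ℝ} {n : ℕ} {T : Set (List Bool)} {θ : ℝ} (N : ℕ)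
    (hT : ∀ σ ∈ T, ¬ N ≤ σ.length) (hθ : 0 < θ) : HasLightCover s n T θ :=
  ⟨∅, by simp, ⟨N, fun σ hσ hl => absurd hl (hT σ hσ)⟩, by simpa [weight] using hθ⟩

theorem weight_term_pos (s : ℝ) (l : ℕ) : (0 : ℝ) < 2 ^ (-(s * (l : ℝ))) := by positivity

theorem weight_union_le (s : ℝ) (U V : Finset (List Bool)) :
    weight s (U ∪ V) ≤ weight s U + weight s V := by
  have h := Finset.sum_union_inter (s₁ := U) (s₂ := V)
    (f := fun σ : List Bool => (2 : ℝ) ^ (-(s * (σ.length : ℝ))))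
  have h' : weight s (U ∪ V) + weight s (U ∩ V) = weight s U + weight s V := h
  linarith [weight_nonneg s (U ∩ V)]

theorem weight_biUnion_le (s : ℝ) (A : Finset (List Bool)) (U : List Bool → Finset (List Bool)) :
    weight s (A.biUnion U) ≤ ∑ σ ∈ A, weight s (U σ) := by
  induction A using Finset.induction_on with
  | empty => simp [weight]
  | insert a A ha ih =>
    rw [Finset.biUnion_insert, Finset.sum_insert ha]
    exact (weight_union_le _ _ _).trans (by linarith)

theorem weight_of_length_eq {s : ℝ} {A : Finset (List Bool)} {k : ℕ} (h : ∀ σ ∈ A, σ.length = k) :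
    weight s A = ∑ _σ ∈ A, (2 : ℝ) ^ (-(s * (k : ℝ))) :=
  Finset.sum_congr rfl fun σ hσ => by rw [h σ hσ]

theorem weight_filter_add (s : ℝ) (V : Finset (List Bool)) (p : List Bool → Prop)
    [DecidablePred p] :
    weight s (V.filter p) + weight s (V.filter fun σ => ¬ p σ) = weight s V :=
  Finset.sum_filter_add_sum_filter_not _ _ _

/-- For a tree code the premeasure is the infimum of the weights of all covers by long strings. -/
theorem H_lt_iff {s : ℝ} {n : ℕ} {Z : ℕ → Bool} (hZ : IsTreeCode Z) {x : ℝ} :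
    H s n Z < x ↔ HasLightCover s n (codedTree Z) x := by
  have hlen := length_restrict Z
  constructor
  · intro h
    obtain ⟨k, hk, hkn⟩ := (((tendsto_H s n hZ).eventually_lt_const h).and
      (eventually_ge_atTop (2 ^ (n + 1)))).exists
    have hlog : n + 1 ≤ Nat.log 2 (k + 1) :=
      Nat.le_log_of_pow_le (by norm_num) (by omega)
    obtain ⟨V, hV, hVw⟩ := exists_isCover_weight_eq s (ν := restrict Z k) (by rwa [hlen])
    rw [hlen] at hV
    refine ⟨V, fun v hv => (hV.1 v hv).1, ⟨Nat.log 2 (k + 1) - 1, fun σ hσ hl => ?_⟩, hVw ▸ hk⟩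
    set m := Nat.log 2 (k + 1) - 1 with hm
    have hlm : (σ.take m).length = m := by rw [List.length_take]; omega
    obtain ⟨v, hv, hvσ⟩ := hV.2 (σ.take m) hlm (restrict_getElem?.2
      ⟨by
        have h1 := strIndex_lt (σ.take m)
        have h2 : 2 ^ Nat.log 2 (k + 1) ≤ k + 1 := Nat.pow_log_le_self 2 (by omega)
        rw [hlm, show m + 1 = Nat.log 2 (k + 1) by omega] at h1
        omega, hZ _ _ hσ (List.take_prefix _ _)⟩)
    exact ⟨v, hv, hvσ.trans (List.take_prefix _ _)⟩
  · rintro ⟨V, hn, ⟨N, hN⟩, hw⟩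
    obtain ⟨m, hm⟩ : ∃ m, n ≤ m ∧ N ≤ m ∧ ∀ v ∈ V, v.length ≤ m :=
      ⟨n + N + V.sup List.length, by omega, by omega, fun v hv =>
        (Finset.le_sup (f := List.length) hv).trans (by omega)⟩
    refine lt_of_le_of_lt ?_ hw
    have hpos : 1 ≤ 2 ^ (m + 1) := Nat.one_le_two_pow
    have hlog : Nat.log 2 ((restrict Z (2 ^ (m + 1) - 1)).length + 1) = m + 1 := by
      rw [hlen, Nat.sub_add_cancel hpos, Nat.log_pow (by norm_num)]
    have hanti : H s n Z ≤ preH s n (restrict Z (2 ^ (m + 1) - 1)) :=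
      (preH_antitone s n hZ).le_of_tendsto (tendsto_H s n hZ) _
    refine hanti.trans (preH_le s (by rw [hlog]; omega) ?_)
    rw [hlog]
    refine ⟨fun v hv => ⟨hn v hv, by simpa using hm.2.2 v hv⟩, fun σ hσ hσZ => ?_⟩
    exact hN σ (restrict_getElem?.1 hσZ).2 (by rw [hσ]; simpa using hm.2.1)

/-! ### The greedy subtree -/

section Greedy

variable {s : ℝ} {J m : ℕ} {q : ℕ → ℝ} {F E : Set (List Bool)}

/-- The strings of `F` above `τ` or above a string of `E` that has the length of `τ` and precedes
`τ` in the enumeration of strings. -/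
def stage (F E : Set (List Bool)) (τ : List Bool) : Set (List Bool) :=
  {σ | σ ∈ F ∧ ∃ ρ, ρ.length = τ.length ∧ ρ <+: σ ∧ (ρ = τ ∨ (strIndex ρ < strIndex τ ∧ ρ ∈ E))}

/-- `E` arises from the tree `F` by going through all strings in order and accepting a string `τ`
of `F` with accepted predecessor, except that at the levels `J * (k + 1)`, `m ≤ k`, the strings
accepted so far, together with `τ`, also have to obey two smallness conditions: the part of `F`
above them has a cover by strings longer than `k` of weight less than `q k`, and the part of this
above the initial segment of `τ` of length `k` has one of weight less than `2 ^ (-s * k)`. -/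
def IsGreedySubtree (s : ℝ) (J m : ℕ) (q : ℕ → ℝ) (F E : Set (List Bool)) : Prop :=
  ∀ τ, τ ∈ E ↔ τ ∈ F ∧ (τ = [] ∨ τ.dropLast ∈ E) ∧
    ∀ k, m ≤ k → τ.length = J * (k + 1) →
      HasLightCover s (k + 1) (extensions (stage F E τ) (τ.take k)) (2 ^ (-(s * (k : ℝ)))) ∧
      HasLightCover s (k + 1) (stage F E τ) (q k)

/-- The strings of `F` whose initial segment of length `J * k` belongs to `E`. -/
def slice (J : ℕ) (F E : Set (List Bool)) (k : ℕ) : Set (List Bool) :=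
  {σ | σ ∈ F ∧ J * k ≤ σ.length ∧ σ.take (J * k) ∈ E}

namespace IsGreedySubtree

theorem subset (h : IsGreedySubtree s J m q F E) : E ⊆ F := fun τ hτ => ((h τ).1 hτ).1

theorem mem_of_prefix (h : IsGreedySubtree s J m q F E) {σ τ : List Bool} (hσ : σ ∈ E)
    (hτ : τ <+: σ) : τ ∈ E := by
  induction σ using List.reverseRecOn with
  | nil => rwa [List.prefix_nil.1 hτ]
  | append_singleton σ b ih =>
    rcases List.prefix_concat_iff.1 hτ with rfl | hτ
    · exact hσ
    · refine ih ?_ hτ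
      simpa using ((h _).1 hσ).2.1

theorem mem_of_length_le (h : IsGreedySubtree s J m q F E)
    (hF : ∀ σ τ, σ ∈ F → τ <+: σ → τ ∈ F) (hJ : 0 < J) {τ : List Bool} (hτ : τ ∈ F)
    (hl : τ.length ≤ J * m) : τ ∈ E := by
  induction τ using List.reverseRecOn with
  | nil =>
    refine (h _).2 ⟨hτ, Or.inl rfl, fun k hk hl => absurd hl ?_⟩
    have : 0 < J * (k + 1) := by positivity
    simpa using this.ne
  | append_singleton σ b ih =>
    rw [List.length_append, List.length_singleton] at hl
    refine (h _).2 ⟨hτ, Or.inr ?_, fun k hk hl' => ?_⟩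
    · simpa using ih (hF _ _ hτ (List.prefix_append _ _)) (by omega)
    · rw [List.length_append, List.length_singleton] at hl'
      have : J * (m + 1) ≤ J * (k + 1) := Nat.mul_le_mul_left _ (by omega)
      rw [mul_add] at this
      omega

theorem mem_of_take_mem (h : IsGreedySubtree s J m q F E)
    (hF : ∀ σ τ, σ ∈ F → τ <+: σ → τ ∈ F) {k : ℕ} {τ : List Bool} (hτ : τ ∈ F)
    (hk : J * k ≤ τ.length) (hτE : τ.take (J * k) ∈ E) (hl : τ.length < J * (k + 1)) : τ ∈ E := by
  induction τ using List.reverseRecOn with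
  | nil => simpa using hτE
  | append_singleton σ b ih =>
    rcases hk.eq_or_lt with hk | hk
    · rwa [hk, List.take_length] at hτE
    · rw [List.length_append, List.length_singleton] at hk hl
      refine (h _).2 ⟨hτ, Or.inr ?_, fun k' hk' hl' => ?_⟩
      · rw [List.take_append_of_le_length (by omega)] at hτE
        simpa using ih (hF _ _ hτ (List.prefix_append _ _)) (by omega) hτE (by omega)
      · rw [List.length_append, List.length_singleton] at hl'
        rw [hl'] at hk hl
        have h1 := Nat.lt_of_mul_lt_mul_left hk
        have h2 := Nat.lt_of_mul_lt_mul_left hl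
        omega

theorem slice_subset (h : IsGreedySubtree s J m q F E) {i j : ℕ} (hij : i ≤ j) :
    slice J F E j ⊆ slice J F E i := by
  rintro σ ⟨h1, h2, h3⟩
  have hle : J * i ≤ J * j := Nat.mul_le_mul_left _ hij
  refine ⟨h1, hle.trans h2, h.mem_of_prefix h3 ?_⟩
  exact List.take_prefix_take_left hle

/-- If some string of length `l` in `E` satisfies `p`, there is a last one, `τ`.  All others precede
it, so that `stage F E τ` takes them into account. -/
theorem exists_last (E : Set (List Bool)) (l : ℕ) (p : List Bool → Prop) :
    (∀ ρ ∈ E, ρ.length = l → ¬ p ρ) ∨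
      ∃ τ ∈ E, τ.length = l ∧ p τ ∧
        ∀ ρ ∈ E, ρ.length = l → p ρ → ρ = τ ∨ strIndex ρ < strIndex τ := by
  classical
  by_cases hne : ((strings l).filter fun ρ => ρ ∈ E ∧ p ρ).Nonempty
  · right
    obtain ⟨τ, hτ, hmax⟩ := Finset.exists_max_image _ strIndex hne
    simp only [Finset.mem_filter, mem_strings] at hτ hmax
    refine ⟨τ, hτ.2.1, hτ.1, hτ.2.2, fun ρ h1 h2 h3 => ?_⟩
    rcases (hmax ρ ⟨h2, h1, h3⟩).eq_or_lt with h | h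
    · exact Or.inl (strIndex_injective h)
    · exact Or.inr h
  · left
    intro ρ h1 h2 h3
    exact hne ⟨ρ, by simp [mem_strings, h1, h2, h3]⟩

theorem hasLightCover_extensions (h : IsGreedySubtree s J m q F E) (hJ : 0 < J) {k : ℕ}
    (hk : m ≤ k) {σ : List Bool} (hσ : σ.length = k) :
    HasLightCover s (k + 1) (extensions (slice J F E (k + 1)) σ) (2 ^ (-(s * (k : ℝ)))) := by
  have hkl : k + 1 ≤ J * (k + 1) := Nat.le_mul_of_pos_left _ hJ
  have htake : ∀ ρ ∈ extensions (slice J F E (k + 1)) σ, (ρ.take (J * (k + 1))).length =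
      J * (k + 1) ∧ (ρ.take (J * (k + 1))).take k = σ := by
    rintro ρ ⟨⟨h1, h2, h3⟩, h4⟩
    refine ⟨by rw [List.length_take]; omega, ?_⟩
    rw [List.take_take, min_eq_left (by omega), take_eq_of_prefix h4 hσ.ge, ← hσ, List.take_length]
  rcases exists_last E (J * (k + 1)) (fun τ => τ.take k = σ) with h0 | ⟨τ, hτ, hl, hp, hmax⟩
  · refine HasLightCover.of_isEmpty 0 (fun ρ hρ _ => ?_) (weight_term_pos s k)
    exact h0 _ hρ.1.2.2 (htake ρ hρ).1 (htake ρ hρ).2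
  · have := (((h τ).1 hτ).2.2 k hk hl).1
    rw [hp] at this
    refine this.of_long 0 fun ρ hρ _ => ⟨⟨hρ.1.1, _, ?_, List.take_prefix (J * (k + 1)) ρ, ?_⟩, hρ.2⟩
    · rw [(htake ρ hρ).1, hl]
    · exact (hmax _ hρ.1.2.2 (htake ρ hρ).1 (htake ρ hρ).2).imp_right fun h => ⟨h, hρ.1.2.2⟩

theorem hasLightCover_slice (h : IsGreedySubtree s J m q F E) {k : ℕ}
    (hk : m ≤ k) (hq : 0 < q k) : HasLightCover s (k + 1) (slice J F E (k + 1)) (q k) := by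
  have htake : ∀ ρ ∈ slice J F E (k + 1), (ρ.take (J * (k + 1))).length = J * (k + 1) := by
    rintro ρ ⟨h1, h2, h3⟩
    rw [List.length_take]
    omega
  rcases exists_last E (J * (k + 1)) (fun _ => True) with h0 | ⟨τ, hτ, hl, hp, hmax⟩
  · refine HasLightCover.of_isEmpty 0 (fun ρ hρ _ => ?_) hq
    exact h0 _ hρ.2.2 (htake ρ hρ) trivial
  · refine (((h τ).1 hτ).2.2 k hk hl).2.of_long 0 fun ρ hρ _ =>
      ⟨hρ.1, _, ?_, List.take_prefix (J * (k + 1)) ρ, ?_⟩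
    · rw [htake ρ hρ, hl]
    · exact (hmax _ hρ.2.2 (htake ρ hρ) trivial).imp_right fun h => ⟨h, hρ.2.2⟩

theorem stage_subset {k : ℕ} {τ : List Bool} (hl : τ.length = J * (k + 1)) :
    stage F E τ ⊆ slice J F E (k + 1) ∪ extensions F τ := by
  rintro σ ⟨hσ, ρ, h1, h2, rfl | ⟨-, h3⟩⟩
  · exact Or.inr ⟨hσ, h2⟩
  · refine Or.inl ⟨hσ, ?_, ?_⟩
    · rw [← hl, ← h1]
      exact h2.length_le
    · rw [← hl, ← h1, take_eq_of_prefix h2 le_rfl, List.take_length]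
      exact h3

/-- Greediness keeps the premeasure large.  If no string was rejected because of the bound `q k` on
the total weight, then in every cylinder of level `k` either nothing was rejected or a cover of what
is left is almost as heavy as the cylinder itself, so that the latter can replace it. -/
theorem not_hasLightCover_succ (h : IsGreedySubtree s J m q F E)
    (hF : ∀ σ τ, σ ∈ F → τ <+: σ → τ ∈ F) (hJ : 0 < J) {k : ℕ} (hk : m ≤ k)
    (hq : 2 ^ k * (2 : ℝ) ^ (-(s * ((J * (k + 1) : ℕ) : ℝ))) ≤ q k - q (k + 1))
    (hlb : ¬ HasLightCover s k (slice J F E k) (q k)) :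
    ¬ HasLightCover s (k + 1) (slice J F E (k + 1)) (q (k + 1)) := by
  classical
  rintro ⟨V, hVn, ⟨N, hN⟩, hVw⟩
  have hkl : k + 1 ≤ J * (k + 1) := Nat.le_mul_of_pos_left _ hJ
  set l := J * (k + 1) with hl
  set ε : ℝ := (2 : ℝ) ^ (-(s * (l : ℝ))) with hε
  have hε0 : 0 < ε := weight_term_pos s l
  -- Adding `τ` to `V` covers everything present at the time when `τ` was examined.
  have hadd : ∀ τ : List Bool, τ.length = l → ∀ σ ∈ stage F E τ, N ≤ σ.length →
      ∃ v ∈ V ∪ {τ}, v <+: σ := by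
    intro τ hτl σ hσ hσN
    rcases stage_subset hτl hσ with hσ | hσ
    · obtain ⟨v, hv, hvσ⟩ := hN σ hσ hσN
      exact ⟨v, Finset.mem_union_left _ hv, hvσ⟩
    · exact ⟨τ, by simp, hσ.2⟩
  have hsingle : ∀ τ : List Bool, τ.length = l → weight s {τ} = ε := by
    intro τ hτl
    simp [weight, hτl, hε]
  let D : Set (List Bool) := {τ | τ.length = l ∧ τ ∉ E ∧ τ ∈ F ∧ τ.take (J * k) ∈ E}
  have hD : ∀ τ ∈ D, ¬ HasLightCover s (k + 1) (extensions (stage F E τ) (τ.take k))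
      (2 ^ (-(s * (k : ℝ)))) := by
    rintro τ ⟨hτl, hτE, hτF, hτk⟩ hcov
    refine hτE ((h τ).2 ⟨hτF, ?_, fun k' hk' hl' => ?_⟩)
    · rcases List.eq_nil_or_concat' τ with rfl | ⟨ρ, b, rfl⟩
      · exact Or.inl rfl
      · right
        have hjk : J * k < l := Nat.mul_lt_mul_of_pos_left (by omega) hJ
        rw [List.length_append, List.length_singleton] at hτl
        rw [List.take_append_of_le_length (by omega)] at hτk
        rw [List.dropLast_concat]
        exact h.mem_of_take_mem hF (hF _ _ hτF (List.prefix_append _ _)) (by omega) hτk (by omega)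
    · have hkk : k' = k := by
        have := Nat.eq_of_mul_eq_mul_left hJ (hl'.symm.trans hτl)
        omega
      subst hkk
      refine ⟨hcov, V ∪ {τ}, ?_, ⟨N, hadd τ hτl⟩, ?_⟩
      · intro v hv
        rcases Finset.mem_union.1 hv with hv | hv
        · exact hVn v hv
        · rw [Finset.mem_singleton.1 hv, hτl]
          exact hkl
      · have h1 := weight_union_le s V {τ}
        rw [hsingle τ hτl] at h1
        have h2 : (1 : ℝ) ≤ 2 ^ k' := one_le_pow₀ (by norm_num)
        nlinarith
  let B : Finset (List Bool) := (strings k).filter fun σ => ∃ τ ∈ D, τ.take k = σ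
  have hBk : ∀ σ ∈ B, σ.length = k := fun σ hσ => mem_strings.1 (Finset.mem_filter.1 hσ).1
  have hB : ∀ σ ∈ B, (2 : ℝ) ^ (-(s * (k : ℝ))) ≤ weight s (V.filter fun v => v.take k = σ) + ε := by
    intro σ hσ
    obtain ⟨τ, hτ, hτσ⟩ := (Finset.mem_filter.1 hσ).2
    by_contra! hlt
    refine hD τ hτ ⟨(V.filter fun v => v.take k = σ) ∪ {τ}, ?_, ⟨N, ?_⟩, ?_⟩
    · intro v hv
      rcases Finset.mem_union.1 hv with hv | hv
      · exact hVn v (Finset.mem_filter.1 hv).1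
      · rw [Finset.mem_singleton.1 hv, hτ.1]
        exact hkl
    · rintro ρ ⟨hρ, hρτ⟩ hρN
      obtain ⟨v, hv, hvρ⟩ := hadd τ hτ.1 ρ hρ hρN
      refine ⟨v, ?_, hvρ⟩
      rcases Finset.mem_union.1 hv with hv | hv
      · refine Finset.mem_union_left _ (Finset.mem_filter.2 ⟨hv, ?_⟩)
        rw [hτσ] at hρτ
        have hvk := hVn v hv
        rw [← take_eq_of_prefix hvρ (by omega), take_eq_of_prefix hρτ (hBk σ hσ).ge, ← hBk σ hσ,
          List.take_length]
      · exact Finset.mem_union_right _ hv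
    · refine (weight_union_le _ _ _).trans_lt ?_
      rwa [hsingle τ hτ.1]
  refine hlb ⟨(V.filter fun v => v.take k ∉ B) ∪ B, ?_, ⟨max N l, ?_⟩, ?_⟩
  · intro v hv
    rcases Finset.mem_union.1 hv with hv | hv
    · have := hVn v (Finset.mem_filter.1 hv).1
      omega
    · exact (hBk v hv).ge
  · rintro σ ⟨hσF, hσl, hσE⟩ hσN
    have hσl' : l ≤ σ.length := le_of_max_le_right hσN
    have hjk : J * k ≤ l := Nat.mul_le_mul_left _ (by omega)
    by_cases hσB : σ.take k ∈ B
    · exact ⟨_, Finset.mem_union_right _ hσB, List.take_prefix _ _⟩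
    · have hσs : σ ∈ slice J F E (k + 1) := by
        refine ⟨hσF, hσl', ?_⟩
        by_contra hnot
        refine hσB (Finset.mem_filter.2 ⟨mem_strings.2 (by rw [List.length_take]; omega),
          σ.take l, ⟨by rw [List.length_take]; omega, hnot, hF _ _ hσF (List.take_prefix _ _), ?_⟩, ?_⟩)
        · rwa [List.take_take, min_eq_left hjk]
        · rw [List.take_take, min_eq_left (by omega)]
      obtain ⟨v, hv, hvσ⟩ := hN σ hσs (le_of_max_le_left hσN)
      have hvk := hVn v hv
      refine ⟨v, Finset.mem_union_left _ (Finset.mem_filter.2 ⟨hv, ?_⟩), hvσ⟩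
      rwa [← take_eq_of_prefix hvσ (by omega)]
  · have h1 := weight_union_le s (V.filter fun v => v.take k ∉ B) B
    have h2 := weight_filter_add s V fun v => v.take k ∈ B
    have h3 : weight s B ≤ ∑ σ ∈ B, (weight s (V.filter fun v => v.take k = σ) + ε) := by
      rw [weight_of_length_eq hBk]
      exact Finset.sum_le_sum hB
    have h4 : ∑ σ ∈ B, weight s (V.filter fun v => v.take k = σ) =
        weight s (V.filter fun v => v.take k ∈ B) := by
      unfold weight
      rw [← Finset.sum_fiberwise_of_maps_to (s := V.filter fun v => v.take k ∈ B) (t := B)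
        (g := fun v => v.take k) (fun v hv => (Finset.mem_filter.1 hv).2)]
      refine Finset.sum_congr rfl fun σ hσ => Finset.sum_congr ?_ fun _ _ => rfl
      ext v
      simp only [Finset.mem_filter, and_assoc]
      constructor
      · rintro ⟨hv, rfl⟩
        exact ⟨hv, hσ, rfl⟩
      · rintro ⟨hv, -, hv'⟩
        exact ⟨hv, hv'⟩
    have h5 : (B.card : ℝ) ≤ 2 ^ k := by
      have : B.card ≤ 2 ^ k := (Finset.card_filter_le _ _).trans (card_strings k).le
      exact_mod_cast this
    rw [Finset.sum_add_distrib, h4, Finset.sum_const, nsmul_eq_mul] at h3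
    nlinarith

theorem not_hasLightCover_slice (h : IsGreedySubtree s J m q F E)
    (hF : ∀ σ τ, σ ∈ F → τ <+: σ → τ ∈ F) (hJ : 0 < J)
    (hq : ∀ k, 2 ^ k * (2 : ℝ) ^ (-(s * ((J * (k + 1) : ℕ) : ℝ))) ≤ q k - q (k + 1))
    (hm : ¬ HasLightCover s m F (q m)) {k : ℕ} (hk : m ≤ k) :
    ¬ HasLightCover s k (slice J F E k) (q k) := by
  induction k, hk using Nat.le_induction with
  | base =>
    refine fun hc => hm (hc.of_long (J * m) fun σ hσ hl => ⟨hσ, hl, ?_⟩)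
    refine h.mem_of_length_le hF hJ (hF _ _ hσ (List.take_prefix _ _)) ?_
    rw [List.length_take]
    exact min_le_left _ _
  | succ k hk ih => exact h.not_hasLightCover_succ hF hJ hk (hq k) ih

/-- A cover of a late slice by long strings can be replaced by one by even longer strings, without
increasing the weight: an element of length `i` may be replaced by the light cover of its part of the
slice with index `i + 1`. -/
theorem exists_covers_longer (h : IsGreedySubtree s J m q F E) (hJ : 0 < J) {n j : ℕ} (hmn : m ≤ n)
    {V : Finset (List Bool)} (hV : ∀ v ∈ V, n ≤ v.length) (hc : Covers (slice J F E j) V) {i : ℕ}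
    (hni : n ≤ i) (hij : i ≤ j) :
    ∃ U : Finset (List Bool), (∀ v ∈ U, i ≤ v.length) ∧ Covers (slice J F E j) U ∧
      weight s U ≤ weight s V := by
  classical
  induction i, hni using Nat.le_induction with
  | base => exact ⟨V, hV, hc, le_rfl⟩
  | succ i hi ih =>
    obtain ⟨U, hU, hcU, hwU⟩ := ih (by omega)
    choose W hW using fun σ : {σ : List Bool // σ.length = i} =>
      h.hasLightCover_extensions hJ (hmn.trans hi) σ.2
    let W' : List Bool → Finset (List Bool) := fun σ => if hσ : σ.length = i then W ⟨σ, hσ⟩ else ∅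
    have hW' : ∀ σ (hσ : σ.length = i), W' σ = W ⟨σ, hσ⟩ := fun σ hσ => dif_pos hσ
    let A := U.filter fun v => v.length = i
    have hA : ∀ v ∈ A, v.length = i := fun v hv => (Finset.mem_filter.1 hv).2
    refine ⟨(U.filter fun v => ¬ v.length = i) ∪ A.biUnion W', ?_, ?_, ?_⟩
    · intro v hv
      rcases Finset.mem_union.1 hv with hv | hv
      · have h1 := hU v (Finset.mem_filter.1 hv).1
        have h2 := (Finset.mem_filter.1 hv).2
        omega
      · obtain ⟨σ, hσ, hv⟩ := Finset.mem_biUnion.1 hv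
        rw [hW' σ (hA σ hσ)] at hv
        exact (hW _).1 v hv
    · obtain ⟨N, hN⟩ := hcU
      choose M hM using fun σ => (hW σ).2.1
      let M' : List Bool → ℕ := fun σ => if hσ : σ.length = i then M ⟨σ, hσ⟩ else 0
      refine ⟨N + A.sup M', fun σ hσ hl => ?_⟩
      obtain ⟨u, hu, huσ⟩ := hN σ hσ (by omega)
      by_cases hui : u.length = i
      · have huA : u ∈ A := Finset.mem_filter.2 ⟨hu, hui⟩
        have hMu : M ⟨u, hui⟩ ≤ σ.length := by
          have hsup : M' u ≤ A.sup M' := Finset.le_sup huA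
          rw [show M' u = M ⟨u, hui⟩ from dif_pos hui] at hsup
          exact hsup.trans ((Nat.le_add_left _ N).trans hl)
        obtain ⟨v, hv, hvσ⟩ := hM ⟨u, hui⟩ σ ⟨h.slice_subset hij hσ, huσ⟩ hMu
        refine ⟨v, Finset.mem_union_right _ (Finset.mem_biUnion.2 ⟨u, huA, ?_⟩), hvσ⟩
        rwa [hW' u hui]
      · exact ⟨u, Finset.mem_union_left _ (Finset.mem_filter.2 ⟨hu, hui⟩), huσ⟩
    · refine le_trans ?_ hwU
      rw [← weight_filter_add s U fun v => v.length = i, add_comm]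
      refine (weight_union_le _ _ _).trans (add_le_add le_rfl ?_)
      refine (weight_biUnion_le _ _ _).trans ?_
      change _ ≤ weight s A
      rw [weight_of_length_eq hA]
      refine Finset.sum_le_sum fun σ hσ => ?_
      rw [hW' σ (hA σ hσ)]
      exact (hW _).2.2.le

/-- A cover of `E` covers a slice with large index, whose covers by long strings have large
weight. -/
theorem lt_weight (h : IsGreedySubtree s J m q F E)
    (hF : ∀ σ τ, σ ∈ F → τ <+: σ → τ ∈ F) (hJ : 0 < J)
    (hq : ∀ k, 2 ^ k * (2 : ℝ) ^ (-(s * ((J * (k + 1) : ℕ) : ℝ))) ≤ q k - q (k + 1))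
    (hm : ¬ HasLightCover s m F (q m)) {c : ℝ} (hc : ∀ k, c < q k) {n : ℕ} (hmn : m ≤ n)
    {V : Finset (List Bool)} (hV : ∀ v ∈ V, n ≤ v.length) (hcov : Covers E V) :
    c < weight s V := by
  obtain ⟨N, hN⟩ := hcov
  have hle : n + N ≤ J * (n + N) := Nat.le_mul_of_pos_left _ hJ
  have hcov' : Covers (slice J F E (n + N)) V := by
    refine ⟨0, fun σ hσ _ => ?_⟩
    obtain ⟨v, hv, hvσ⟩ := hN _ hσ.2.2 (by rw [List.length_take, min_eq_left hσ.2.1]; omega)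
    exact ⟨v, hv, hvσ.trans (List.take_prefix _ _)⟩
  obtain ⟨U, hU, hcU, hwU⟩ :=
    h.exists_covers_longer hJ hmn hV hcov' (i := n + N) (by omega) le_rfl
  by_contra! hlt
  exact h.not_hasLightCover_slice hF hJ hq hm (k := n + N) (by omega)
    ⟨U, hU, hcU, (hwU.trans hlt).trans_lt (hc _)⟩

theorem hasLightCover (h : IsGreedySubtree s J m q F E) {k : ℕ} (hk : m ≤ k) (hq : 0 < q k) :
    HasLightCover s (k + 1) E (q k) :=
  (h.hasLightCover_slice hk hq).of_long (J * (k + 1)) fun _ hσ hl =>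
    ⟨h.subset hσ, hl, h.mem_of_prefix hσ (List.take_prefix _ _)⟩

end IsGreedySubtree

/-- The tree obtained by the greedy procedure is infinite, and its premeasures tend to the limit of
the bounds `q`. -/
theorem infinite_and_tendsto_H_of_isGreedySubtree {Z_F Z_E : ℕ → Bool} (hF : IsTreeCode Z_F)
    (h : IsGreedySubtree s J m q (codedTree Z_F) (codedTree Z_E)) (hJ : 0 < J)
    (hq : ∀ k, 2 ^ k * (2 : ℝ) ^ (-(s * ((J * (k + 1) : ℕ) : ℝ))) ≤ q k - q (k + 1))
    {c : ℝ} (hc0 : 0 ≤ c) (hc : ∀ k, c < q k) (hqc : Tendsto q atTop (𝓝 c))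
    (hm : q m ≤ H s m Z_F) :
    IsTreeCode Z_E ∧ IsNontrivial Z_E ∧ Tendsto (fun n => H s n Z_E) atTop (𝓝 c) := by
  have hE : IsTreeCode Z_E := fun σ τ hσ hτ => h.mem_of_prefix hσ hτ
  have hm' : ¬ HasLightCover s m (codedTree Z_F) (q m) := by
    rw [← H_lt_iff hF]
    exact hm.not_gt
  have hlow : ∀ n, m ≤ n → ∀ V : Finset (List Bool), (∀ v ∈ V, n ≤ v.length) →
      Covers (codedTree Z_E) V → c < weight s V := fun n hn V hV hcov =>
    h.lt_weight hF hJ hq hm' hc hn hV hcov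
  refine ⟨hE, fun hfin => ?_, ?_⟩
  · -- A finite tree would be covered by the empty set.
    obtain ⟨N, hN⟩ := (hfin.image List.length).bddAbove
    have := hlow m le_rfl ∅ (by simp) ⟨N + 1, fun σ hσ hl => by
      have := hN (Set.mem_image_of_mem _ hσ)
      omega⟩
    simp only [weight, Finset.sum_empty] at this
    exact absurd this hc0.not_gt
  · refine (tendsto_add_atTop_iff_nat 1).1 ?_
    refine tendsto_of_tendsto_of_tendsto_of_le_of_le' tendsto_const_nhds hqc ?_ ?_
    · filter_upwards [eventually_ge_atTop m] with k hk
      by_contra! hlt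
      obtain ⟨V, hV, hcov, hw⟩ := (H_lt_iff hE).1 hlt
      exact hw.not_gt (hlow _ (by omega) V hV hcov)
    · filter_upwards [eventually_ge_atTop m] with k hk
      exact ((H_lt_iff hE).2 (h.hasLightCover hk (hc0.trans_lt (hc k)))).le

end Greedy

/-! ### Computable approximations of the weights and of the bounds -/

theorem exists_computable_of_forall_exists {r : ℕ → ℕ → Bool} (hr : Computable₂ r)
    (h : ∀ x, ∃ w, r x w = true) : ∃ f : ℕ → ℕ, Computable f ∧ ∀ x, r x (f x) = true := by
  have hdom : ∀ x, (Nat.rfind fun w => Part.some (r x w)).Dom := fun x => by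
    obtain ⟨w, hw⟩ := h x
    exact Nat.rfind_dom'.2 ⟨w, by simpa using hw.symm, fun _ => trivial⟩
  refine ⟨fun x => (Nat.rfind fun w => Part.some (r x w)).get (hdom x), ?_, fun x => ?_⟩
  · exact (Partrec.rfind hr.partrec₂).of_eq_tot fun x => Part.get_mem _
  · exact (Part.mem_some_iff.1 (Nat.rfind_spec (Part.get_mem (hdom x)))).symm

/-- A nonnegative computable real has a computable sequence of nonnegative rational
approximations. -/
theorem IsComputableReal.exists_approx {x : ℝ} (hx : IsComputableReal x) (h0 : 0 ≤ x) :
    ∃ a d : ℕ → ℕ, Computable a ∧ Computable d ∧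
      ∀ n, |x - (a n : ℝ) / ((d n : ℝ) + 1)| ≤ ((2 : ℝ) ^ n)⁻¹ := by
  obtain ⟨a, b, d, ha, hb, hd, h⟩ := hx
  refine ⟨fun n => a n - b n, d, Primrec.nat_sub.to_comp.comp ha hb, hd, fun n => ?_⟩
  show |x - ((a n - b n : ℕ) : ℝ) / ((d n : ℝ) + 1)| ≤ ((2 : ℝ) ^ n)⁻¹
  rcases le_total (b n) (a n) with hab | hab
  · rw [Nat.cast_sub hab]
    exact h n
  · rw [Nat.sub_eq_zero_of_le hab, Nat.cast_zero, zero_div, sub_zero, abs_of_nonneg h0]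
    have h1 : ((a n : ℝ) - b n) / ((d n : ℝ) + 1) ≤ 0 :=
      div_nonpos_of_nonpos_of_nonneg (sub_nonpos.2 (by exact_mod_cast hab)) (by positivity)
    linarith [(abs_le.1 (h n)).2]

theorem primrec_pow : Primrec₂ ((· ^ ·) : ℕ → ℕ → ℕ) :=
  Primrec₂.unpaired'.1 Nat.Primrec.pow

theorem primrec_log_two : Primrec (Nat.log 2) := by
  have h : PrimrecRel fun y k : ℕ => 2 ^ k ≤ y :=
    Primrec.nat_le.comp (primrec_pow.comp (Primrec.const 2) Primrec.snd) Primrec.fst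
  refine (Primrec.nat_findGreatest Primrec.id h).of_eq fun y => ?_
  rcases Nat.eq_zero_or_pos y with rfl | hy
  · simp
  · rw [Nat.findGreatest_eq_iff]
    refine ⟨Nat.log_le_self 2 y, fun _ => Nat.pow_log_le_self 2 hy.ne', fun n hn _ => ?_⟩
    exact not_le.2 (Nat.lt_pow_of_log_lt (by norm_num) hn)

/-- A positive computable real lies between computable sequences of rationals `u / v` and `u' / v`
that converge to it. -/
theorem exists_rational_bounds {s : ℝ} (hs : 0 < s) (hs_comp : IsComputableReal s) :
    ∃ u u' v : ℕ → ℕ, Computable u ∧ Computable u' ∧ Computable v ∧ (∀ n, 0 < v n) ∧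
      (∀ n, (u n : ℝ) ≤ s * v n) ∧ (∀ n, s * v n ≤ u' n) ∧
      Tendsto (fun n => (u n : ℝ) / v n) atTop (𝓝 s) ∧
      Tendsto (fun n => (u' n : ℝ) / v n) atTop (𝓝 s) := by
  obtain ⟨a, d, ha, hd, h⟩ := hs_comp.exists_approx hs.le
  have hpow : Computable fun n : ℕ => 2 ^ n :=
    (primrec_pow.comp (Primrec.const 2) Primrec.id).to_comp
  have hX : Computable fun n => a n * 2 ^ n := Primrec.nat_mul.to_comp.comp ha hpow
  have hd1 : Computable fun n => d n + 1 := Computable.succ.comp hd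
  have hv : ∀ n, (0 : ℝ) < (d n + 1) * 2 ^ n := fun n => by positivity
  have hmul : ∀ n, |s * ((d n + 1) * 2 ^ n) - a n * 2 ^ n| ≤ (d n : ℝ) + 1 := fun n => by
    have h1 := mul_le_mul_of_nonneg_right (h n) (hv n).le
    rw [← abs_of_pos (hv n), ← abs_mul, abs_of_pos (hv n)] at h1
    have h2 : (s - (a n : ℝ) / (d n + 1)) * ((d n + 1) * 2 ^ n) =
        s * ((d n + 1) * 2 ^ n) - a n * 2 ^ n := by
      field_simp
    have h3 : ((2 : ℝ) ^ n)⁻¹ * ((d n + 1) * 2 ^ n) = d n + 1 := by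
      field_simp
    rwa [h2, h3] at h1
  have hlow : ∀ n, ((a n * 2 ^ n - (d n + 1) : ℕ) : ℝ) ≤ s * (((d n + 1) * 2 ^ n : ℕ) : ℝ) := by
    intro n
    have h1 := abs_le.1 (hmul n)
    push_cast
    rcases le_total (d n + 1) (a n * 2 ^ n) with h2 | h2
    · rw [Nat.cast_sub h2]
      push_cast
      linarith [h1.1]
    · rw [Nat.sub_eq_zero_of_le h2]
      have := mul_pos hs (hv n)
      simpa using this.le
  have hup : ∀ n, s * (((d n + 1) * 2 ^ n : ℕ) : ℝ) ≤ ((a n * 2 ^ n + (d n + 1) : ℕ) : ℝ) := by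
    intro n
    have h1 := abs_le.1 (hmul n)
    push_cast
    linarith [h1.2]
  have hdiff : ∀ n, ((a n * 2 ^ n + (d n + 1) : ℕ) : ℝ) - ((a n * 2 ^ n - (d n + 1) : ℕ) : ℝ) ≤
      2 * ((d n : ℝ) + 1) := by
    intro n
    have : a n * 2 ^ n + (d n + 1) ≤ (a n * 2 ^ n - (d n + 1)) + 2 * (d n + 1) := by omega
    have h' : ((a n * 2 ^ n + (d n + 1) : ℕ) : ℝ) ≤
        ((a n * 2 ^ n - (d n + 1) : ℕ) : ℝ) + 2 * ((d n : ℝ) + 1) := by exact_mod_cast this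
    linarith
  have hdiv : ∀ n, 2 * ((d n : ℝ) + 1) / (((d n + 1) * 2 ^ n : ℕ) : ℝ) = 2 * (2⁻¹ : ℝ) ^ n := by
    intro n
    rw [inv_pow]
    push_cast
    field_simp
  have hzero : Tendsto (fun n : ℕ => 2 * (2⁻¹ : ℝ) ^ n) atTop (𝓝 0) := by
    simpa using (tendsto_pow_atTop_nhds_zero_of_lt_one (r := (2⁻¹ : ℝ)) (by norm_num)
      (by norm_num)).const_mul 2
  have hv' : ∀ n, (0 : ℝ) < (((d n + 1) * 2 ^ n : ℕ) : ℝ) := fun n => by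
    push_cast
    exact hv n
  refine ⟨fun n => a n * 2 ^ n - (d n + 1), fun n => a n * 2 ^ n + (d n + 1),
    fun n => (d n + 1) * 2 ^ n, Primrec.nat_sub.to_comp.comp hX hd1,
    Primrec.nat_add.to_comp.comp hX hd1, Primrec.nat_mul.to_comp.comp hd1 hpow,
    fun n => by positivity, hlow, hup, ?_, ?_⟩
  · refine tendsto_of_tendsto_of_tendsto_of_le_of_le (g := fun n => s - 2 * (2⁻¹ : ℝ) ^ n)
      (by simpa using hzero.const_sub s) tendsto_const_nhds (fun n => ?_) (fun n => ?_)
    · show s - 2 * (2⁻¹ : ℝ) ^ n ≤ _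
      rw [← hdiv, sub_le_iff_le_add, ← add_div, le_div_iff₀ (hv' n)]
      linarith [hup n, hdiff n]
    · exact (div_le_iff₀ (hv' n)).2 (hlow n)
  · refine tendsto_of_tendsto_of_tendsto_of_le_of_le (h := fun n => s + 2 * (2⁻¹ : ℝ) ^ n)
      tendsto_const_nhds (by simpa using hzero.const_add s) (fun n => ?_) (fun n => ?_)
    · exact (le_div_iff₀ (hv' n)).2 (hup n)
    · show _ ≤ s + 2 * (2⁻¹ : ℝ) ^ n
      rw [← hdiv, div_le_iff₀ (hv' n), add_mul, div_mul_cancel₀ _ (hv' n).ne']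
      linarith [hlow n, hdiff n]

/-- The weights `2 ^ (-s * l)` can be computed to any precision `2 ^ (-p)`. -/
theorem exists_computable_weight {s : ℝ} (hs : 0 < s) (hs_comp : IsComputableReal s) :
    ∃ a : ℕ → ℕ → ℕ, Computable₂ a ∧ ∀ p l : ℕ,
      (2 : ℝ) ^ p * 2 ^ (-(s * (l : ℝ))) < a p l ∧
      (a p l : ℝ) < 2 ^ p * 2 ^ (-(s * (l : ℝ))) + 2 := by
  obtain ⟨u, u', v, hu, hu', hv, hv0, hus, hsu, hlu, hlu'⟩ := exists_rational_bounds hs hs_comp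
  -- `r (p, l) (n, i)` verifies that `i - 2 < 2 ^ p * 2 ^ (-s * l) < i`, by comparing `v n`-th powers
  -- after replacing `s` by one of its rational bounds with index `n`.
  let r : ℕ → ℕ → Bool := fun x w =>
    decide (2 ^ (x.unpair.1 * v w.unpair.1) <
      w.unpair.2 ^ v w.unpair.1 * 2 ^ (x.unpair.2 * u w.unpair.1)) &&
    decide ((w.unpair.2 - 2) ^ v w.unpair.1 * 2 ^ (x.unpair.2 * u' w.unpair.1) <
      2 ^ (x.unpair.1 * v w.unpair.1))
  have hr : Computable₂ r := by
    have hlt := (Primrec.nat_lt.decide).to_comp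
    have hpow := primrec_pow.to_comp
    have hmul := Primrec.nat_mul.to_comp
    have x1 : Computable fun z : ℕ × ℕ => z.1.unpair.1 :=
      (Primrec.fst.comp (Primrec.unpair.comp Primrec.fst)).to_comp
    have x2 : Computable fun z : ℕ × ℕ => z.1.unpair.2 :=
      (Primrec.snd.comp (Primrec.unpair.comp Primrec.fst)).to_comp
    have w1 : Computable fun z : ℕ × ℕ => z.2.unpair.1 :=
      (Primrec.fst.comp (Primrec.unpair.comp Primrec.snd)).to_comp
    have w2 : Computable fun z : ℕ × ℕ => z.2.unpair.2 :=
      (Primrec.snd.comp (Primrec.unpair.comp Primrec.snd)).to_comp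
    have two : Computable fun _ : ℕ × ℕ => 2 := Computable.const 2
    have w3 : Computable fun z : ℕ × ℕ => z.2.unpair.2 - 2 :=
      Primrec.nat_sub.to_comp.comp w2 two
    have hv' := hv.comp w1
    have hp := hpow.comp two (hmul.comp x1 hv')
    exact Primrec.and.to_comp.comp
      (hlt.comp hp (hmul.comp (hpow.comp w2 hv') (hpow.comp two (hmul.comp x2 (hu.comp w1)))))
      (hlt.comp (hmul.comp (hpow.comp w3 hv') (hpow.comp two (hmul.comp x2 (hu'.comp w1)))) hp)
  have hneg : ∀ l : ℕ, (2 : ℝ) ^ (-(s * (l : ℝ))) = ((2 : ℝ) ^ (s * (l : ℝ)))⁻¹ := fun l =>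
    Real.rpow_neg (by norm_num) _
  have hpos : ∀ l : ℕ, (0 : ℝ) < (2 : ℝ) ^ (s * (l : ℝ)) := fun l => by positivity
  have hvpow : ∀ (l n : ℕ), ((2 : ℝ) ^ (s * (l : ℝ))) ^ v n = 2 ^ (l * (s * v n)) := fun l n => by
    rw [← Real.rpow_natCast, ← Real.rpow_mul (by norm_num)]
    congr 1
    ring
  have hex : ∀ x, ∃ w, r x w = true := by
    intro x
    set p := x.unpair.1 with hp
    set l := x.unpair.2 with hl
    set y : ℝ := 2 ^ p * 2 ^ (-(s * (l : ℝ))) with hy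
    have hy0 : 0 ≤ y := by positivity
    have hy' : y * 2 ^ (s * (l : ℝ)) = 2 ^ p := by
      rw [hy, hneg, inv_mul_cancel_right₀ (hpos l).ne']
    set i := ⌊y⌋₊ + 1 with hi
    have h1 : (2 : ℝ) ^ p < i * 2 ^ (s * (l : ℝ)) := by
      rw [← hy']
      refine mul_lt_mul_of_pos_right ?_ (hpos l)
      rw [hi]
      push_cast
      exact Nat.lt_floor_add_one y
    have h2 : ((i - 2 : ℕ) : ℝ) * 2 ^ (s * (l : ℝ)) < 2 ^ p := by
      rcases Nat.eq_zero_or_pos ⌊y⌋₊ with h0 | h0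
      · rw [hi, h0]
        simp
      · rw [← hy']
        refine mul_lt_mul_of_pos_right ?_ (hpos l)
        refine lt_of_lt_of_le ?_ (Nat.floor_le hy0)
        exact_mod_cast (show i - 2 < ⌊y⌋₊ by omega)
    have hcont : ∀ t : ℕ → ℝ, Tendsto t atTop (𝓝 s) →
        Tendsto (fun n => (2 : ℝ) ^ (t n * (l : ℝ))) atTop (𝓝 (2 ^ (s * (l : ℝ)))) :=
      fun t ht => tendsto_const_nhds.rpow (ht.mul_const _) (Or.inl (by norm_num))
    obtain ⟨n, hn1, hn2⟩ := ((((hcont _ hlu).const_mul (i : ℝ)).eventually_const_lt h1).and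
      (((hcont _ hlu').const_mul ((i - 2 : ℕ) : ℝ)).eventually_lt_const h2)).exists
    have hconv : ∀ t : ℕ, ((2 : ℝ) ^ ((t : ℝ) / v n * (l : ℝ))) ^ v n = 2 ^ (l * t) := fun t => by
      have hvn : (v n : ℝ) ≠ 0 := by exact_mod_cast (hv0 n).ne'
      rw [← Real.rpow_natCast, ← Real.rpow_mul (by norm_num), ← Real.rpow_natCast]
      congr 1
      push_cast
      field_simp
    refine ⟨Nat.pair n i, ?_⟩
    simp only [r, Nat.unpair_pair, Bool.and_eq_true, decide_eq_true_eq, ← hp, ← hl]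
    constructor
    · have := pow_lt_pow_left₀ hn1 (by positivity) (hv0 n).ne'
      rw [mul_pow, hconv, ← pow_mul] at this
      exact_mod_cast this
    · have := pow_lt_pow_left₀ hn2 (by positivity) (hv0 n).ne'
      rw [mul_pow, hconv, ← pow_mul] at this
      exact_mod_cast this
  obtain ⟨f, hf, hfr⟩ := exists_computable_of_forall_exists hr hex
  refine ⟨fun p l => (f (Nat.pair p l)).unpair.2, ?_, fun p l => ?_⟩
  · exact (Primrec.snd.comp Primrec.unpair).to_comp.comp (hf.comp Primrec₂.natPair.to_comp)
  · have h := hfr (Nat.pair p l)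
    set n := (f (Nat.pair p l)).unpair.1 with hn
    set i := (f (Nat.pair p l)).unpair.2 with hi
    simp only [r, Nat.unpair_pair, Bool.and_eq_true, decide_eq_true_eq, ← hn, ← hi] at h
    obtain ⟨h1, h2⟩ := h
    have h1' : (2 : ℝ) ^ (p * v n) < (i : ℝ) ^ v n * 2 ^ (l * u n) := by exact_mod_cast h1
    have h2' : ((i - 2 : ℕ) : ℝ) ^ v n * 2 ^ (l * u' n) < (2 : ℝ) ^ (p * v n) := by
      exact_mod_cast h2
    have hlo : (2 : ℝ) ^ (l * u n) ≤ ((2 : ℝ) ^ (s * (l : ℝ))) ^ v n := by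
      rw [hvpow, ← Real.rpow_natCast]
      refine Real.rpow_le_rpow_of_exponent_le (by norm_num) ?_
      push_cast
      exact mul_le_mul_of_nonneg_left (hus n) (by positivity)
    have hhi : ((2 : ℝ) ^ (s * (l : ℝ))) ^ v n ≤ (2 : ℝ) ^ (l * u' n) := by
      rw [hvpow, ← Real.rpow_natCast]
      refine Real.rpow_le_rpow_of_exponent_le (by norm_num) ?_
      push_cast
      exact mul_le_mul_of_nonneg_left (hsu n) (by positivity)
    have g1 : (2 : ℝ) ^ p < i * 2 ^ (s * (l : ℝ)) := by
      refine lt_of_pow_lt_pow_left₀ (v n) (by positivity) ?_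
      rw [← pow_mul, mul_pow]
      exact h1'.trans_le (mul_le_mul_of_nonneg_left hlo (by positivity))
    have g2 : ((i - 2 : ℕ) : ℝ) * 2 ^ (s * (l : ℝ)) < 2 ^ p := by
      refine lt_of_pow_lt_pow_left₀ (v n) (by positivity) ?_
      rw [← pow_mul, mul_pow]
      exact (mul_le_mul_of_nonneg_left hhi (by positivity)).trans_lt h2'
    rw [hneg, ← div_eq_mul_inv]
    refine ⟨(div_lt_iff₀ (hpos l)).2 g1, ?_⟩
    have g3 := (lt_div_iff₀ (hpos l)).2 g2
    have g4 : (i : ℝ) ≤ ((i - 2 : ℕ) : ℝ) + 2 := by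
      exact_mod_cast (show i ≤ i - 2 + 2 by omega)
    linarith

/-- A computable sequence of dyadic rationals that decreases to `c` in steps of at least
`2 ^ (-k) / 4`. -/
theorem exists_computable_bound {c : ℝ} (hc : 0 ≤ c) (hc_comp : IsComputableReal c) :
    ∃ b : ℕ → ℕ, Computable b ∧ (∀ k, c < (b k : ℝ) / 2 ^ k) ∧
      Tendsto (fun k => (b k : ℝ) / 2 ^ k) atTop (𝓝 c) ∧
      ∀ k, ((2 : ℝ) ^ k)⁻¹ / 4 ≤ (b k : ℝ) / 2 ^ k - (b (k + 1) : ℝ) / 2 ^ (k + 1) := by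
  obtain ⟨a, d, ha, hd, h⟩ := hc_comp.exists_approx hc
  -- Up to rounding this is `2 ^ k * c + 4`, with an error between `-3 / 2` and `1 / 2`.
  let b : ℕ → ℕ := fun k => 2 ^ k * a (k + 1) / (d (k + 1) + 1) + 4
  have hb : Computable b := by
    have hpow : Computable fun n : ℕ => 2 ^ n :=
      (primrec_pow.comp (Primrec.const 2) Primrec.id).to_comp
    exact Primrec.nat_add.to_comp.comp (Primrec.nat_div.to_comp.comp
      (Primrec.nat_mul.to_comp.comp hpow (ha.comp Computable.succ))
      (Computable.succ.comp (hd.comp Computable.succ))) (Computable.const 4)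
  have hbound : ∀ k, c + 5 / 2 * ((2 : ℝ) ^ k)⁻¹ < (b k : ℝ) / 2 ^ k ∧
      (b k : ℝ) / 2 ^ k ≤ c + 9 / 2 * ((2 : ℝ) ^ k)⁻¹ := by
    intro k
    have h2 : (0 : ℝ) < 2 ^ k := by positivity
    obtain ⟨h3, h4⟩ := abs_le.1 (h (k + 1))
    set y : ℝ := (a (k + 1) : ℝ) / (d (k + 1) + 1) with hy
    have hf : b k = ⌊2 ^ k * y⌋₊ + 4 := by
      have : (2 ^ k * y : ℝ) = ((2 ^ k * a (k + 1) : ℕ) : ℝ) / ((d (k + 1) + 1 : ℕ) : ℝ) := by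
        rw [hy]
        push_cast
        ring
      rw [this, Nat.floor_div_eq_div]
    have hy0 : 0 ≤ 2 ^ k * y := by positivity
    have h5 := Nat.floor_le hy0
    have h6 := Nat.lt_floor_add_one (2 ^ k * y)
    have h7 : (2 : ℝ) ^ k * ((2 : ℝ) ^ (k + 1))⁻¹ = 1 / 2 := by
      rw [pow_succ]
      field_simp
    have h8 : (2 : ℝ) ^ k * ((2 : ℝ) ^ k)⁻¹ = 1 := mul_inv_cancel₀ h2.ne'
    have h9 : (b k : ℝ) = (⌊2 ^ k * y⌋₊ : ℝ) + 4 := by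
      rw [hf]
      push_cast
      rfl
    have h10 := mul_le_mul_of_nonneg_left h3 h2.le
    have h11 := mul_le_mul_of_nonneg_left h4 h2.le
    rw [lt_div_iff₀ h2, div_le_iff₀ h2]
    constructor <;> nlinarith
  refine ⟨b, hb, fun k => ?_, ?_, fun k => ?_⟩
  · have : (0 : ℝ) < ((2 : ℝ) ^ k)⁻¹ := by positivity
    linarith [(hbound k).1]
  · have hzero : Tendsto (fun k : ℕ => ((2 : ℝ) ^ k)⁻¹) atTop (𝓝 0) := by
      simpa using tendsto_pow_atTop_nhds_zero_of_lt_one (r := (2⁻¹ : ℝ)) (by norm_num)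
        (by norm_num)
    refine tendsto_of_tendsto_of_tendsto_of_le_of_le
      (g := fun k => c + 5 / 2 * ((2 : ℝ) ^ k)⁻¹) (h := fun k => c + 9 / 2 * ((2 : ℝ) ^ k)⁻¹)
      (by simpa using (hzero.const_mul (5 / 2)).const_add c)
      (by simpa using (hzero.const_mul (9 / 2)).const_add c)
      (fun k => (hbound k).1.le) (fun k => (hbound k).2)
  · have h1 := (hbound k).1
    have h2 := (hbound (k + 1)).2
    have h3 : ((2 : ℝ) ^ (k + 1))⁻¹ = ((2 : ℝ) ^ k)⁻¹ / 2 := by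
      rw [pow_succ]
      field_simp
    rw [h3] at h2
    linarith

/-! ### Strings as numbers -/

theorem two_pow_length_le (σ : List Bool) : 2 ^ σ.length ≤ strIndex σ + 1 := by
  induction σ using List.reverseRecOn with
  | nil => simp
  | append_singleton σ b ih =>
    rw [strIndex_append_singleton, List.length_append, List.length_singleton, pow_succ]
    omega

theorem log_strIndex (σ : List Bool) : Nat.log 2 (strIndex σ + 1) = σ.length :=
  Nat.log_eq_of_pow_le_of_lt_pow (two_pow_length_le σ) (strIndex_lt σ)

theorem strIndex_append_div (σ ρ : List Bool) :
    (strIndex (σ ++ ρ) + 1) / 2 ^ ρ.length = strIndex σ + 1 := by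
  induction ρ using List.reverseRecOn with
  | nil => simp
  | append_singleton ρ b ih =>
    rw [← List.append_assoc, strIndex_append_singleton, List.length_append, List.length_singleton,
      pow_succ', ← Nat.div_div_eq_div_mul]
    have hb := Bool.toNat_le b
    rw [show (2 * strIndex (σ ++ ρ) + 1 + b.toNat + 1) / 2 = strIndex (σ ++ ρ) + 1 by omega, ih]

theorem strIndex_take (σ : List Bool) (l : ℕ) :
    (strIndex σ + 1) / 2 ^ (σ.length - l) = strIndex (σ.take l) + 1 := by
  have h := strIndex_append_div (σ.take l) (σ.drop l)
  rwa [List.take_append_drop, List.length_drop] at h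

/-- The string `σ` with `strIndex σ + 1 = y`, for positive `y`. -/
noncomputable def strOf (y : ℕ) : List Bool :=
  Function.surjInv strIndex_surjective (y - 1)

theorem strIndex_strOf {y : ℕ} (hy : 1 ≤ y) : strIndex (strOf y) + 1 = y := by
  rw [strOf, Function.surjInv_eq strIndex_surjective]
  omega

theorem length_strOf {y : ℕ} (hy : 1 ≤ y) : (strOf y).length = Nat.log 2 y := by
  rw [← log_strIndex, strIndex_strOf hy]

/-! ### The conditions of the greedy procedure are recursively enumerable -/

/-- The sum of the approximate weights, with precision `p`, of a list of strings, where a string `σ`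
is represented by the number `strIndex σ + 1`. -/
def approxWeight (a : ℕ → ℕ → ℕ) (p : ℕ) (V : List ℕ) : ℕ :=
  (V.map fun v => a p (Nat.log 2 v)).sum

theorem computable_approxWeight {a : ℕ → ℕ → ℕ} (ha : Computable₂ a) :
    Computable₂ (approxWeight a) := by
  have h : Computable fun x : ℕ × List ℕ => Nat.rec (motive := fun _ => ℕ) 0
      (fun i acc => acc + a x.1 (Nat.log 2 (x.2.getD i 0))) x.2.length := by
    refine Computable.nat_rec (f := fun x : ℕ × List ℕ => x.2.length) (g := fun _ => 0)
      (h := fun x z => z.2 + a x.1 (Nat.log 2 (x.2.getD z.1 0)))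
      (Primrec.list_length.comp Primrec.snd).to_comp (Computable.const 0) ?_
    refine Primrec.nat_add.to_comp.comp (Primrec.snd.comp Primrec.snd).to_comp
      (ha.comp (Primrec.fst.comp Primrec.fst).to_comp (Primrec.to_comp ?_))
    exact primrec_log_two.comp ((Primrec.list_getD 0).comp (Primrec.snd.comp Primrec.fst)
      (Primrec.fst.comp Primrec.snd))
  refine h.of_eq fun x => ?_
  obtain ⟨p, V⟩ := x
  have key : ∀ i ≤ V.length, Nat.rec (motive := fun _ => ℕ) 0
      (fun i acc => acc + a p (Nat.log 2 (V.getD i 0))) i = approxWeight a p (V.take i) := by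
    intro i
    induction i with
    | zero => intro _; simp [approxWeight]
    | succ i ih =>
      intro hi
      have hi' : i < V.length := by omega
      rw [List.take_add_one, List.getElem?_eq_getElem hi']
      simp only [ih (by omega), approxWeight, List.map_append, List.sum_append]
      simp [List.getD_eq_getElem?_getD, hi']
  have := key V.length le_rfl
  rwa [List.take_length] at this

section Threshold

variable {s : ℝ} {a : ℕ → ℕ → ℕ}

theorem weight_image_strOf_le (s : ℝ) {V : List ℕ} (hV : ∀ v ∈ V, 1 ≤ v) :
    weight s (V.toFinset.image strOf) ≤
      (V.map fun v => (2 : ℝ) ^ (-(s * (Nat.log 2 v : ℝ)))).sum := by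
  induction V with
  | nil => simp [weight]
  | cons v V ih =>
    rw [List.toFinset_cons, Finset.image_insert, Finset.insert_eq, List.map_cons, List.sum_cons]
    refine (weight_union_le _ _ _).trans (add_le_add (le_of_eq ?_)
      (ih fun v hv => hV v (List.mem_cons_of_mem _ hv)))
    simp [weight, length_strOf (hV v List.mem_cons_self)]

theorem weight_le_approxWeight
    (ha : ∀ p l : ℕ, (2 : ℝ) ^ p * 2 ^ (-(s * (l : ℝ))) < a p l ∧
      (a p l : ℝ) < 2 ^ p * 2 ^ (-(s * (l : ℝ))) + 2) (p : ℕ) (V : List ℕ) :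
    2 ^ p * (V.map fun v => (2 : ℝ) ^ (-(s * (Nat.log 2 v : ℝ)))).sum ≤ approxWeight a p V ∧
      (approxWeight a p V : ℝ) ≤
        2 ^ p * (V.map fun v => (2 : ℝ) ^ (-(s * (Nat.log 2 v : ℝ)))).sum + 2 * V.length := by
  induction V with
  | nil => simp [approxWeight]
  | cons v V ih =>
    have h := ha p (Nat.log 2 v)
    have hc : (approxWeight a p (v :: V) : ℝ) = a p (Nat.log 2 v) + approxWeight a p V := by
      simp [approxWeight]
    rw [hc, List.map_cons, List.sum_cons, List.length_cons]
    push_cast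
    constructor <;> linarith [h.1, h.2, ih.1, ih.2]

theorem eventually_approxWeight_lt
    (ha : ∀ p l : ℕ, (2 : ℝ) ^ p * 2 ^ (-(s * (l : ℝ))) < a p l ∧
      (a p l : ℝ) < 2 ^ p * 2 ^ (-(s * (l : ℝ))) + 2)
    {t : ℕ → ℕ} {θ : ℝ} (ht : ∀ p, 2 ^ p * θ ≤ (t p : ℝ) + 2) {V : List ℕ}
    (hV : (V.map fun v => (2 : ℝ) ^ (-(s * (Nat.log 2 v : ℝ)))).sum < θ) :
    ∀ᶠ p in atTop, approxWeight a p V < t p := by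
  set x := (V.map fun v => (2 : ℝ) ^ (-(s * (Nat.log 2 v : ℝ)))).sum with hx
  have hlim : Tendsto (fun p : ℕ => (2 : ℝ) ^ p * (θ - x)) atTop atTop :=
    (tendsto_pow_atTop_atTop_of_one_lt (by norm_num)).atTop_mul_const (sub_pos.2 hV)
  filter_upwards [hlim.eventually_gt_atTop (2 * (V.length : ℝ) + 2)] with p hp
  have h1 := (weight_le_approxWeight ha p V).2
  have h2 := ht p
  have : (approxWeight a p V : ℝ) < t p := by
    rw [← hx] at h1
    nlinarith
  exact_mod_cast this

end Threshold

/-- With `ν` the part of the characteristic function of `E` below the index of a string `τ`,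
with `ζ` a part of that of the tree `F`, and with strings `σ` represented by `strIndex σ + 1`:
every string of length `μ` in `extensions (stage F E τ) (τ.take κ)` has an initial segment
in `V`. -/
def CoverCheck (ν ζ : List Bool) (μ κ : ℕ) (V : List ℕ) : Prop :=
  Nat.log 2 (ν.length + 1) ≤ μ ∧ ∀ y < 2 ^ (μ + 1), y < 2 ^ μ ∨ ζ[y - 1]? = some false ∨
    ¬ (y / 2 ^ (μ - Nat.log 2 (ν.length + 1)) = ν.length + 1 ∨
      ν[y / 2 ^ (μ - Nat.log 2 (ν.length + 1)) - 1]? = some true) ∨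
    ¬ (y / 2 ^ (μ - κ) = (ν.length + 1) / 2 ^ (Nat.log 2 (ν.length + 1) - κ)) ∨
    ∃ d < μ + 1, y / 2 ^ d ∈ V

theorem primrecPred_exists_lt {α : Type} [Primcodable α] {r : ℕ → α → Prop} (hr : PrimrecRel r)
    {f : α → ℕ} (hf : Primrec f) : PrimrecPred fun x => ∃ y < f x, r y x :=
  (hr.exists_mem_list.comp (Primrec.list_range.comp hf) Primrec.id).of_eq (by simp)

theorem primrecPred_forall_lt {α : Type} [Primcodable α] {r : ℕ → α → Prop} (hr : PrimrecRel r)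
    {f : α → ℕ} (hf : Primrec f) : PrimrecPred fun x => ∀ y < f x, r y x :=
  (hr.forall_mem_list.comp (Primrec.list_range.comp hf) Primrec.id).of_eq (by simp)

theorem primrecPred_coverCheck :
    PrimrecPred fun x : List Bool × List Bool × ℕ × ℕ × List ℕ =>
      CoverCheck x.1 x.2.1 x.2.2.1 x.2.2.2.1 x.2.2.2.2 := by
  have fν : Primrec fun x : List Bool × List Bool × ℕ × ℕ × List ℕ => x.1 := Primrec.fst
  have fζ : Primrec fun x : List Bool × List Bool × ℕ × ℕ × List ℕ => x.2.1 :=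
    Primrec.fst.comp Primrec.snd
  have fμ : Primrec fun x : List Bool × List Bool × ℕ × ℕ × List ℕ => x.2.2.1 :=
    Primrec.fst.comp (Primrec.snd.comp Primrec.snd)
  have fκ : Primrec fun x : List Bool × List Bool × ℕ × ℕ × List ℕ => x.2.2.2.1 :=
    Primrec.fst.comp (Primrec.snd.comp (Primrec.snd.comp Primrec.snd))
  have fV : Primrec fun x : List Bool × List Bool × ℕ × ℕ × List ℕ => x.2.2.2.2 :=
    Primrec.snd.comp (Primrec.snd.comp (Primrec.snd.comp Primrec.snd))
  have fn : Primrec fun x : List Bool × List Bool × ℕ × ℕ × List ℕ => x.1.length + 1 :=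
    Primrec.succ.comp (Primrec.list_length.comp fν)
  have fl := primrec_log_two.comp fn
  have fμ1 : Primrec fun x : List Bool × List Bool × ℕ × ℕ × List ℕ => x.2.2.1 + 1 :=
    Primrec.succ.comp fμ
  have pow2 : ∀ {α : Type} [Primcodable α] {f : α → ℕ}, Primrec f → Primrec fun z => 2 ^ f z :=
    fun hf => primrec_pow.comp (Primrec.const 2) hf
  have hmem : PrimrecRel fun (V : List ℕ) (y : ℕ) => y ∈ V :=
    (Primrec.eq (α := ℕ)).exists_mem_list.of_eq fun V y => by simp
  have hcov : PrimrecRel fun (y : ℕ) (x : List Bool × List Bool × ℕ × ℕ × List ℕ) =>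
      ∃ d < x.2.2.1 + 1, y / 2 ^ d ∈ x.2.2.2.2 := by
    have : PrimrecRel fun (d : ℕ) (z : ℕ × List Bool × List Bool × ℕ × ℕ × List ℕ) =>
        z.1 / 2 ^ d ∈ z.2.2.2.2.2 :=
      hmem.comp (fV.comp (Primrec.snd.comp Primrec.snd))
        (Primrec.nat_div.comp (Primrec.fst.comp Primrec.snd) (pow2 Primrec.fst))
    exact primrecPred_exists_lt this (fμ1.comp Primrec.snd)
  have hdiv : Primrec fun z : ℕ × List Bool × List Bool × ℕ × ℕ × List ℕ =>
      z.1 / 2 ^ (z.2.2.2.1 - Nat.log 2 (z.2.1.length + 1)) :=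
    Primrec.nat_div.comp Primrec.fst
      (pow2 (Primrec.nat_sub.comp (fμ.comp Primrec.snd) (fl.comp Primrec.snd)))
  have hbody : PrimrecRel fun (y : ℕ) (x : List Bool × List Bool × ℕ × ℕ × List ℕ) =>
      y < 2 ^ x.2.2.1 ∨ x.2.1[y - 1]? = some false ∨
      ¬ (y / 2 ^ (x.2.2.1 - Nat.log 2 (x.1.length + 1)) = x.1.length + 1 ∨
        x.1[y / 2 ^ (x.2.2.1 - Nat.log 2 (x.1.length + 1)) - 1]? = some true) ∨
      ¬ (y / 2 ^ (x.2.2.1 - x.2.2.2.1) =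
        (x.1.length + 1) / 2 ^ (Nat.log 2 (x.1.length + 1) - x.2.2.2.1)) ∨
      ∃ d < x.2.2.1 + 1, y / 2 ^ d ∈ x.2.2.2.2 := by
    refine PrimrecPred.or (Primrec.nat_lt.comp Primrec.fst (pow2 (fμ.comp Primrec.snd))) ?_
    refine PrimrecPred.or (Primrec.eq.comp (Primrec.list_getElem?.comp (fζ.comp Primrec.snd)
      (Primrec.pred.comp Primrec.fst)) (Primrec.const _)) ?_
    refine PrimrecPred.or (PrimrecPred.not (PrimrecPred.or
      (Primrec.eq.comp hdiv (fn.comp Primrec.snd))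
      (Primrec.eq.comp (Primrec.list_getElem?.comp (fν.comp Primrec.snd)
        (Primrec.pred.comp hdiv)) (Primrec.const _)))) ?_
    refine PrimrecPred.or (PrimrecPred.not (Primrec.eq.comp ?_ ?_)) hcov
    · exact Primrec.nat_div.comp Primrec.fst
        (pow2 (Primrec.nat_sub.comp (fμ.comp Primrec.snd) (fκ.comp Primrec.snd)))
    · exact Primrec.nat_div.comp (fn.comp Primrec.snd)
        (pow2 (Primrec.nat_sub.comp (fl.comp Primrec.snd) (fκ.comp Primrec.snd)))
  exact (Primrec.nat_le.comp fl fμ).and (primrecPred_forall_lt hbody (pow2 fμ1))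

theorem mem_extensions_stage_iff {F E : Set (List Bool)} {σ τ : List Bool} {κ : ℕ}
    (hσ : τ.length ≤ σ.length) (hκ : κ ≤ τ.length) :
    σ ∈ extensions (stage F E τ) (τ.take κ) ↔ σ ∈ F ∧
      (σ.take τ.length = τ ∨
        (strIndex (σ.take τ.length) < strIndex τ ∧ σ.take τ.length ∈ E)) ∧
      σ.take κ = τ.take κ := by
  have hpre : τ.take κ <+: σ ↔ σ.take κ = τ.take κ := by
    rw [List.prefix_iff_eq_take, List.length_take, min_eq_left hκ, eq_comm]
  simp only [extensions, stage, Set.mem_ofPred_eq, hpre, and_assoc]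
  refine and_congr_right fun _ => and_congr_left fun _ => ?_
  constructor
  · rintro ⟨ρ, hl, hρ, h⟩
    rwa [show σ.take τ.length = ρ by rw [← hl, ← List.prefix_iff_eq_take.1 hρ]]
  · intro h
    exact ⟨_, by rw [List.length_take, min_eq_left hσ], List.take_prefix _ _, h⟩

/-- The meaning of `CoverCheck` in terms of strings; those with index at least `K` count as members
of `F`. -/
theorem coverCheck_restrict_iff {Z_F Y : ℕ → Bool} {τ : List Bool} {μ κ K : ℕ} {V : List ℕ}
    (hμ : τ.length ≤ μ) :
    CoverCheck (restrict Y (strIndex τ)) (restrict Z_F K) μ κ V ↔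
      ∀ σ : List Bool, σ.length = μ → (strIndex σ < K → σ ∈ codedTree Z_F) →
        (σ.take τ.length = τ ∨ (strIndex (σ.take τ.length) < strIndex τ ∧
          σ.take τ.length ∈ codedTree Y)) →
        σ.take κ = τ.take κ → ∃ ρ, ρ <+: σ ∧ strIndex ρ + 1 ∈ V := by
  have hζ : ∀ σ : List Bool, (restrict Z_F K)[strIndex σ]? = some false ↔
      ¬ (strIndex σ < K → σ ∈ codedTree Z_F) := by
    intro σ
    by_cases h : strIndex σ < K <;> simp [restrict, codedTree, h]
  have hinj : ∀ ρ ρ' : List Bool, strIndex ρ + 1 = strIndex ρ' + 1 ↔ ρ = ρ' := fun ρ ρ' => by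
    rw [Nat.add_right_cancel_iff, strIndex_injective.eq_iff]
  have hd : ∀ σ : List Bool, σ.length = μ → ((∃ d < μ + 1, (strIndex σ + 1) / 2 ^ d ∈ V) ↔
      ∃ ρ, ρ <+: σ ∧ strIndex ρ + 1 ∈ V) := by
    intro σ hσ
    constructor
    · rintro ⟨d, hd, h⟩
      refine ⟨σ.take (μ - d), List.take_prefix _ _, ?_⟩
      rwa [← strIndex_take σ, hσ, show μ - (μ - d) = d by omega]
    · rintro ⟨ρ, hρ, h⟩
      refine ⟨μ - ρ.length, by omega, ?_⟩
      rwa [← hσ, strIndex_take σ, ← List.prefix_iff_eq_take.1 hρ]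
  have hbody : ∀ σ : List Bool, σ.length = μ →
      ((restrict Z_F K)[strIndex σ + 1 - 1]? = some false ∨
        ¬ ((strIndex σ + 1) / 2 ^ (μ - τ.length) = strIndex τ + 1 ∨
          (restrict Y (strIndex τ))[(strIndex σ + 1) / 2 ^ (μ - τ.length) - 1]? = some true) ∨
        ¬ ((strIndex σ + 1) / 2 ^ (μ - κ) = (strIndex τ + 1) / 2 ^ (τ.length - κ)) ∨
        (∃ d < μ + 1, (strIndex σ + 1) / 2 ^ d ∈ V) ↔
      ((strIndex σ < K → σ ∈ codedTree Z_F) →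
        (σ.take τ.length = τ ∨ (strIndex (σ.take τ.length) < strIndex τ ∧
          σ.take τ.length ∈ codedTree Y)) →
        σ.take κ = τ.take κ → ∃ ρ, ρ <+: σ ∧ strIndex ρ + 1 ∈ V)) := by
    intro σ hσ
    rw [hd σ hσ, ← hσ, strIndex_take σ, strIndex_take σ, strIndex_take τ, hinj, hinj, Nat.add_sub_cancel, Nat.add_sub_cancel, hζ,
      restrict_getElem?]
    tauto
  rw [CoverCheck, length_restrict, log_strIndex]
  constructor
  · rintro ⟨-, h⟩ σ hσ
    refine (hbody σ hσ).1 ((h (strIndex σ + 1) ?_).resolve_left ?_)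
    · rw [← hσ]
      exact strIndex_lt σ
    · rw [← hσ]
      exact not_lt.2 (two_pow_length_le σ)
  · refine fun h => ⟨hμ, fun y hy => ?_⟩
    rcases lt_or_ge y (2 ^ μ) with hy' | hy'
    · exact Or.inl hy'
    · right
      have hy1 : 1 ≤ y := Nat.one_le_two_pow.trans hy'
      have hl : (strOf y).length = μ := by
        rw [length_strOf hy1]
        exact Nat.log_eq_of_pow_le_of_lt_pow hy' hy
      have := (hbody (strOf y) hl).2 (h _ hl)
      rwa [strIndex_strOf hy1] at this

/-- All strings of the list, represented by numbers, are longer than `k` and together they form a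
cover in the sense of `CoverCheck` whose approximate weight is less than `t`. -/
def LightCoverCheck (a : ℕ → ℕ → ℕ) (ν ζ : List Bool) (k κ p μ t : ℕ) (V : List ℕ) : Prop :=
  ((∀ v ∈ V, k < Nat.log 2 v) ∧ CoverCheck ν ζ μ κ V) ∧ approxWeight a p V < t

section LightCoverCheck

variable {s : ℝ} {a : ℕ → ℕ → ℕ} {t : ℕ → ℕ} {θ : ℝ} {Z_F Y : ℕ → Bool} {τ : List Bool} {k κ : ℕ}

theorem hasLightCover_of_lightCoverCheck (hF : IsTreeCode Z_F)
    (ha : ∀ p l : ℕ, (2 : ℝ) ^ p * 2 ^ (-(s * (l : ℝ))) < a p l ∧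
      (a p l : ℝ) < 2 ^ p * 2 ^ (-(s * (l : ℝ))) + 2)
    (ht : ∀ p, (t p : ℝ) ≤ 2 ^ p * θ) (hκ : κ ≤ τ.length) {p μ K : ℕ} {V : List ℕ}
    (h : LightCoverCheck a (restrict Y (strIndex τ)) (restrict Z_F K) k κ p μ (t p) V) :
    HasLightCover s (k + 1)
      (extensions (stage (codedTree Z_F) (codedTree Y) τ) (τ.take κ)) θ := by
  obtain ⟨⟨hlen, hcov⟩, hw⟩ := h
  have hμ : τ.length ≤ μ := by
    have := hcov.1
    rwa [length_restrict, log_strIndex] at this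
  have hpos : ∀ v ∈ V, 1 ≤ v := by
    intro v hv
    have := hlen v hv
    by_contra! h0
    rw [Nat.lt_one_iff.1 h0] at this
    simp at this
  rw [coverCheck_restrict_iff hμ] at hcov
  refine ⟨V.toFinset.image strOf, ?_, ⟨μ, fun σ hσ hl => ?_⟩, ?_⟩
  · simp only [Finset.mem_image, List.mem_toFinset]
    rintro _ ⟨v, hv, rfl⟩
    rw [length_strOf (hpos v hv)]
    exact hlen v hv
  · rw [mem_extensions_stage_iff (hμ.trans hl) hκ] at hσ
    obtain ⟨ρ, hρ, hρV⟩ := hcov (σ.take μ) (by rw [List.length_take, min_eq_left hl])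
      (fun _ => hF _ _ hσ.1 (List.take_prefix _ _))
      (by rw [List.take_take, min_eq_left hμ]; exact hσ.2.1)
      (by rw [List.take_take, min_eq_left (hκ.trans hμ)]; exact hσ.2.2)
    refine ⟨ρ, ?_, hρ.trans (List.take_prefix _ _)⟩
    refine Finset.mem_image.2 ⟨_, List.mem_toFinset.2 hρV, strIndex_injective ?_⟩
    exact Nat.add_right_cancel (strIndex_strOf (hpos _ hρV))
  · refine (weight_image_strOf_le s hpos).trans_lt ?_
    have h1 := (weight_le_approxWeight ha p V).1
    have h2 : (approxWeight a p V : ℝ) < t p := by exact_mod_cast hw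
    exact lt_of_mul_lt_mul_left (h1.trans_lt (h2.trans_le (ht p))) (by positivity)

/-- A light cover is recognized with every sufficiently large precision and level, so that several
covers can share them. -/
theorem HasLightCover.exists_lightCoverCheck
    (ha : ∀ p l : ℕ, (2 : ℝ) ^ p * 2 ^ (-(s * (l : ℝ))) < a p l ∧
      (a p l : ℝ) < 2 ^ p * 2 ^ (-(s * (l : ℝ))) + 2)
    (ht : ∀ p, 2 ^ p * θ ≤ (t p : ℝ) + 2) (hκ : κ ≤ τ.length)
    (h : HasLightCover s (k + 1)
      (extensions (stage (codedTree Z_F) (codedTree Y) τ) (τ.take κ)) θ) :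
    ∃ V : List ℕ, ∀ᶠ p in atTop, LightCoverCheck a (restrict Y (strIndex τ))
      (restrict Z_F (2 ^ (p + 1))) k κ p p (t p) V := by
  obtain ⟨U, hU, ⟨N, hN⟩, hw⟩ := h
  refine ⟨U.toList.map fun σ => strIndex σ + 1, ?_⟩
  have hsum : ((U.toList.map fun σ => strIndex σ + 1).map
      fun v => (2 : ℝ) ^ (-(s * (Nat.log 2 v : ℝ)))).sum < θ := by
    rw [List.map_map]
    simp only [Function.comp_def, log_strIndex]
    rwa [Finset.sum_map_toList]
  filter_upwards [eventually_approxWeight_lt ha ht hsum, eventually_ge_atTop N,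
    eventually_ge_atTop τ.length] with p hp hpN hpτ
  refine ⟨⟨?_, (coverCheck_restrict_iff hpτ).2 fun σ hσ h1 h2 h3 => ?_⟩, hp⟩
  · simp only [List.mem_map, Finset.mem_toList]
    rintro _ ⟨σ, hσ, rfl⟩
    rw [log_strIndex]
    exact hU σ hσ
  · have hσK : strIndex σ < 2 ^ (p + 1) := by
      have := strIndex_lt σ
      rw [hσ] at this
      omega
    obtain ⟨v, hv, hvσ⟩ := hN σ ((mem_extensions_stage_iff (hσ ▸ hpτ) hκ).2 ⟨h1 hσK, h2, h3⟩)
      (hσ ▸ hpN)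
    exact ⟨v, hvσ, List.mem_map.2 ⟨v, Finset.mem_toList.2 hv, rfl⟩⟩

end LightCoverCheck

open Classical in
/-- The decision of the greedy procedure about the string `τ` with index `ν.length`, where `ν` is
the list of the earlier decisions, verified by means of the part `ζ` of the code of `F` and of a
witness `w`, which encodes a precision, a level and two covers. -/
noncomputable def greedyCheck (a : ℕ → ℕ → ℕ) (b : ℕ → ℕ) (J m : ℕ) (ν : List Bool) (w : ℕ)
    (ζ : List Bool) : Bool :=
  let x := Denumerable.ofNat (ℕ × ℕ × List ℕ × List ℕ) w
  let l := Nat.log 2 (ν.length + 1)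
  let k := l / J - 1
  decide (ζ[ν.length]? = some true ∧ (ν.length = 0 ∨ ν[(ν.length - 1) / 2]? = some true)) &&
  (decide (¬ (l % J = 0 ∧ m + 1 ≤ l / J)) ||
    (decide (LightCoverCheck a ν ζ k k x.1 x.2.1 (a x.1 k - 2) x.2.2.1) &&
      decide (LightCoverCheck a ν ζ k 0 x.1 x.2.1 (b k * 2 ^ x.1 / 2 ^ k) x.2.2.2)))

open Classical in
theorem computable_lightCoverCheck {a : ℕ → ℕ → ℕ} (ha : Computable₂ a)
    {α : Type} [Primcodable α] {ν ζ : α → List Bool} {k κ p μ t : α → ℕ} {V : α → List ℕ}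
    (hν : Primrec ν) (hζ : Primrec ζ) (hk : Primrec k) (hκ : Primrec κ) (hp : Primrec p)
    (hμ : Primrec μ) (ht : Computable t) (hV : Primrec V) :
    Computable fun x =>
      decide (LightCoverCheck a (ν x) (ζ x) (k x) (κ x) (p x) (μ x) (t x) (V x)) := by
  have h1 : PrimrecRel fun (V : List ℕ) (k : ℕ) => ∀ v ∈ V, k < Nat.log 2 v :=
    PrimrecRel.forall_mem_list
      (R := fun v k => k < Nat.log 2 v)
      (Primrec.nat_lt.comp Primrec.snd (primrec_log_two.comp Primrec.fst))
  have h2 := (h1.comp hV hk).and (primrecPred_coverCheck.comp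
    (hν.pair (hζ.pair (hμ.pair (hκ.pair hV)))))
  have h3 : Computable fun x => decide (approxWeight a (p x) (V x) < t x) :=
    Primrec.nat_lt.decide.to_comp.comp
      ((computable_approxWeight ha).comp hp.to_comp hV.to_comp) ht
  refine (Primrec.and.to_comp.comp h2.decide.to_comp h3).of_eq fun x => ?_
  rw [← Bool.decide_and]
  exact decide_eq_decide.2 Iff.rfl

theorem computable_greedyCheck {a : ℕ → ℕ → ℕ} {b : ℕ → ℕ} (ha : Computable₂ a)
    (hb : Computable b) (J m : ℕ) :
    Computable fun x : List Bool × ℕ × List Bool => greedyCheck a b J m x.1 x.2.1 x.2.2 := by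
  classical
  have fν : Primrec fun x : List Bool × ℕ × List Bool => x.1 := Primrec.fst
  have fζ : Primrec fun x : List Bool × ℕ × List Bool => x.2.2 := Primrec.snd.comp Primrec.snd
  have fw : Primrec fun x : List Bool × ℕ × List Bool =>
      Denumerable.ofNat (ℕ × ℕ × List ℕ × List ℕ) x.2.1 :=
    (Primrec.ofNat _).comp (Primrec.fst.comp Primrec.snd)
  have fp := Primrec.fst.comp fw
  have fμ := Primrec.fst.comp (Primrec.snd.comp fw)
  have fV := Primrec.fst.comp (Primrec.snd.comp (Primrec.snd.comp fw))
  have fU := Primrec.snd.comp (Primrec.snd.comp (Primrec.snd.comp fw))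
  have fn : Primrec fun x : List Bool × ℕ × List Bool => x.1.length := Primrec.list_length.comp fν
  have fl := primrec_log_two.comp (Primrec.succ.comp fn)
  have fd : Primrec fun x : List Bool × ℕ × List Bool => Nat.log 2 (x.1.length + 1) / J :=
    Primrec.nat_div.comp fl (Primrec.const J)
  have fk : Primrec fun x : List Bool × ℕ × List Bool => Nat.log 2 (x.1.length + 1) / J - 1 :=
    Primrec.nat_sub.comp fd (Primrec.const 1)
  have h1 := (PrimrecPred.and (Primrec.eq.comp (Primrec.list_getElem?.comp fζ fn)
      (Primrec.const (some true)))
    (PrimrecPred.or (Primrec.eq.comp fn (Primrec.const 0))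
      (Primrec.eq.comp (Primrec.list_getElem?.comp fν (Primrec.nat_div.comp
        (Primrec.nat_sub.comp fn (Primrec.const 1)) (Primrec.const 2)))
        (Primrec.const (some true))))).decide.to_comp
  have h2 := (PrimrecPred.not (PrimrecPred.and
    (Primrec.eq.comp (Primrec.nat_mod.comp fl (Primrec.const J)) (Primrec.const 0))
    (Primrec.nat_le.comp (Primrec.const (m + 1)) fd))).decide.to_comp
  have pow2 : ∀ {α : Type} [Primcodable α] {f : α → ℕ}, Primrec f → Primrec fun z => 2 ^ f z :=
    fun hf => primrec_pow.comp (Primrec.const 2) hf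
  have t1 := Primrec.nat_sub.to_comp.comp (ha.comp fp.to_comp fk.to_comp) (Computable.const 2)
  have t2 := Primrec.nat_div.to_comp.comp (Primrec.nat_mul.to_comp.comp (hb.comp fk.to_comp)
    (pow2 fp).to_comp) (pow2 fk).to_comp
  exact Primrec.and.to_comp.comp h1 (Primrec.or.to_comp.comp h2 (Primrec.and.to_comp.comp
    (computable_lightCoverCheck ha fν fζ fk fk fp fμ t1 fV)
    (computable_lightCoverCheck ha fν fζ fk (Primrec.const 0) fp fμ t2 fU)))

/-- A set that satisfies the recursion given by `greedyCheck` is a greedy subtree. -/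
theorem isGreedySubtree_of_greedyCheck {s : ℝ} {a : ℕ → ℕ → ℕ} {b : ℕ → ℕ} {J m : ℕ}
    {Z_F Y : ℕ → Bool} (hF : IsTreeCode Z_F) (hJ : 0 < J)
    (ha : ∀ p l : ℕ, (2 : ℝ) ^ p * 2 ^ (-(s * (l : ℝ))) < a p l ∧
      (a p l : ℝ) < 2 ^ p * 2 ^ (-(s * (l : ℝ))) + 2)
    (hY : ∀ n, Y n = true ↔
      ∃ K w, greedyCheck a b J m (restrict Y n) w (restrict Z_F K) = true) :
    IsGreedySubtree s J m (fun k => (b k : ℝ) / 2 ^ k) (codedTree Z_F) (codedTree Y) := by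
  have ht1 : ∀ k p, ((a p k - 2 : ℕ) : ℝ) ≤ 2 ^ p * 2 ^ (-(s * (k : ℝ))) ∧
      2 ^ p * 2 ^ (-(s * (k : ℝ))) ≤ ((a p k - 2 : ℕ) : ℝ) + 2 := by
    intro k p
    have h := ha p k
    have h0 : (0 : ℝ) ≤ 2 ^ p * 2 ^ (-(s * (k : ℝ))) := by positivity
    rcases le_total 2 (a p k) with h2 | h2
    · rw [Nat.cast_sub h2]
      push_cast
      constructor <;> linarith [h.1, h.2]
    · rw [Nat.sub_eq_zero_of_le h2]
      have h2' : (a p k : ℝ) ≤ 2 := by exact_mod_cast h2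
      push_cast
      constructor <;> linarith [h.1, h.2]
  have ht2 : ∀ k p, ((b k * 2 ^ p / 2 ^ k : ℕ) : ℝ) ≤ 2 ^ p * ((b k : ℝ) / 2 ^ k) ∧
      2 ^ p * ((b k : ℝ) / 2 ^ k) ≤ ((b k * 2 ^ p / 2 ^ k : ℕ) : ℝ) + 2 := by
    intro k p
    have heq : (2 : ℝ) ^ p * ((b k : ℝ) / 2 ^ k) = ((b k * 2 ^ p : ℕ) : ℝ) / ((2 ^ k : ℕ) : ℝ) := by
      push_cast
      ring
    rw [heq, ← Nat.floor_div_eq_div (K := ℝ)]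
    have h1 := Nat.floor_le (a := ((b k * 2 ^ p : ℕ) : ℝ) / ((2 ^ k : ℕ) : ℝ)) (by positivity)
    have h2 := Nat.lt_floor_add_one (((b k * 2 ^ p : ℕ) : ℝ) / ((2 ^ k : ℕ) : ℝ))
    exact ⟨h1, by linarith⟩
  intro τ
  have hlog := log_strIndex τ
  have hpar : (strIndex τ = 0 ∨ (restrict Y (strIndex τ))[(strIndex τ - 1) / 2]? = some true) ↔
      (τ = [] ∨ τ.dropLast ∈ codedTree Y) := by
    rcases List.eq_nil_or_concat' τ with rfl | ⟨ρ, c, rfl⟩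
    · simp [strIndex]
    · have hc := Bool.toNat_le c
      rw [strIndex_append_singleton,
        show (2 * strIndex ρ + 1 + c.toNat - 1) / 2 = strIndex ρ by omega, restrict_getElem?,
        List.dropLast_concat]
      constructor
      · rintro (h | h)
        · omega
        · exact Or.inr h.2
      · rintro (h | h)
        · simp at h
        · exact Or.inr ⟨by omega, h⟩
  have hlevel : ∀ {k}, τ.length = J * (k + 1) → τ.length % J = 0 ∧ τ.length / J = k + 1 := by
    intro k hk
    rw [hk]
    exact ⟨Nat.mul_mod_right _ _, Nat.mul_div_cancel_left _ hJ⟩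
  have hkτ : τ.length / J - 1 ≤ τ.length := (Nat.sub_le _ _).trans (Nat.div_le_self _ _)
  have hmem : τ ∈ codedTree Y ↔ ∃ K w,
      greedyCheck a b J m (restrict Y (strIndex τ)) w (restrict Z_F K) = true := hY _
  rw [hmem]
  simp only [greedyCheck, length_restrict, hlog, Bool.and_eq_true, Bool.or_eq_true,
    decide_eq_true_eq, hpar, restrict_getElem?]
  set k := τ.length / J - 1 with hk
  constructor
  · rintro ⟨K, w, ⟨⟨-, hτF⟩, hτp⟩, h⟩
    refine ⟨hτF, hτp, fun k' hk' hl => ?_⟩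
    obtain ⟨h1, h2⟩ := hlevel hl
    have hkk : k = k' := by omega
    rcases h with h | ⟨h3, h4⟩
    · exact absurd ⟨h1, by omega⟩ h
    · rw [← hkk]
      refine ⟨hasLightCover_of_lightCoverCheck (t := fun p => a p k - 2) hF ha
        (fun p => (ht1 k p).1) hkτ h3, ?_⟩
      have := hasLightCover_of_lightCoverCheck (t := fun p => b k * 2 ^ p / 2 ^ k) hF ha
        (fun p => (ht2 k p).1) (Nat.zero_le _) h4
      refine this.of_long 0 fun σ hσ _ => ⟨hσ, ?_⟩
      simp
  · rintro ⟨hτF, hτp, h⟩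
    by_cases hc : τ.length % J = 0 ∧ m + 1 ≤ τ.length / J
    · have hl : τ.length = J * (k + 1) := by
        have := Nat.div_add_mod τ.length J
        rw [show k + 1 = τ.length / J by omega]
        omega
      obtain ⟨h3, h4⟩ := h k (by omega) hl
      obtain ⟨V, hV⟩ := h3.exists_lightCoverCheck (t := fun p => a p k - 2) ha
        (fun p => (ht1 k p).2) hkτ
      have h4' : HasLightCover s (k + 1)
          (extensions (stage (codedTree Z_F) (codedTree Y) τ) (τ.take 0)) ((b k : ℝ) / 2 ^ k) :=
        h4.of_long 0 fun σ hσ _ => hσ.1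
      obtain ⟨U, hU⟩ := h4'.exists_lightCoverCheck (t := fun p => b k * 2 ^ p / 2 ^ k) ha
        (fun p => (ht2 k p).2) (Nat.zero_le _)
      obtain ⟨p, hpV, hpU, hpτ⟩ :=
        (hV.and (hU.and (eventually_ge_atTop τ.length))).exists
      refine ⟨2 ^ (p + 1), Encodable.encode (p, p, V, U), ⟨⟨?_, hτF⟩, hτp⟩, Or.inr ?_⟩
      · have h5 := strIndex_lt τ
        have h6 : 2 ^ (τ.length + 1) ≤ 2 ^ (p + 1) :=
          Nat.pow_le_pow_right (by norm_num) (by omega)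
        omega
      · rw [Denumerable.ofNat_encode]
        exact ⟨hpV, hpU⟩
    · exact ⟨strIndex τ + 1, 0, ⟨⟨Nat.lt_succ_self _, hτF⟩, hτp⟩, Or.inl hc⟩

end CantorSpace

theorem mainTheorem2 (Z_F : ℕ → Bool) (c s : ℝ)
    (hF : CantorSpace.IsTreeCode Z_F) (hF_nontrivial : CantorSpace.IsNontrivial Z_F)
    (hc : 0 ≤ c) (hs : 0 < s)
    (hc_comp : CantorSpace.IsComputableReal c) (hs_comp : CantorSpace.IsComputableReal s)
    (L : EReal)
    (hL : Tendsto (fun n : ℕ => (CantorSpace.H s n Z_F : EReal)) atTop (𝓝 L))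
    (hcL : (c : EReal) ≤ L) :
    ∃ Z_E : ℕ → Bool,
      CantorSpace.IsTreeCode Z_E ∧ CantorSpace.IsNontrivial Z_E ∧
      CantorSpace.closedSet Z_E ⊆ CantorSpace.closedSet Z_F ∧
      TuringReducible (CantorSpace.charFn Z_E)
        (CantorSpace.charFn (CantorSpace.turingJump Z_F)) ∧
      Tendsto (fun n : ℕ => CantorSpace.H s n Z_E) atTop (𝓝 c) := by
  rcases hcL.eq_or_lt with rfl | hcL
  · -- If `c` is the limit for `F` itself, take `E = F`.
    have hR : Computable fun x : List Bool × ℕ × List Bool =>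
        decide (x.2.2[x.1.length]? = some true) :=
      ((Primrec.eq.comp (Primrec.list_getElem?.comp (Primrec.snd.comp Primrec.snd)
        (Primrec.list_length.comp Primrec.fst)) (Primrec.const (some true))).decide).to_comp
    obtain ⟨Y, hY, hYZ⟩ := CantorSpace.exists_turingReducible_turingJump (Z := Z_F)
      (R := fun ν _ ζ => decide (ζ[ν.length]? = some true)) hR
    have : Y = Z_F := by
      funext n
      rw [Bool.eq_iff_iff, hYZ]
      simp only [CantorSpace.length_restrict, decide_eq_true_eq]
      constructor
      · rintro ⟨k, -, h⟩
        by_cases hn : n < k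
        · simpa [CantorSpace.restrict, hn] using h
        · simp [CantorSpace.restrict, hn] at h
      · intro h
        exact ⟨n + 1, 0, by simp [CantorSpace.restrict, h]⟩
    exact ⟨Z_F, hF, hF_nontrivial, subset_rfl, this ▸ hY, EReal.tendsto_coe.1 hL⟩
  · obtain ⟨a, ha, haw⟩ := CantorSpace.exists_computable_weight hs hs_comp
    obtain ⟨b, hb, hcb, hbc, hbd⟩ := CantorSpace.exists_computable_bound hc hc_comp
    -- With `4 ≤ s * J` a string of length `J * (k + 1)` weighs at most `2 ^ (-k)` times the
    -- gap between `q k` and `q (k + 1)`, where `q k = b k / 2 ^ k`.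
    obtain ⟨J, hJ⟩ := exists_nat_ge (4 / s)
    rw [div_le_iff₀ hs] at hJ
    have hJ0 : 0 < J := by
      rcases Nat.eq_zero_or_pos J with rfl | h
      · norm_num at hJ
      · exact h
    obtain ⟨r, hcr, hrL⟩ := EReal.lt_iff_exists_real_btwn.1 hcL
    obtain ⟨m, hm1, hm2⟩ := ((hL.eventually_const_lt hrL).and
      (hbc.eventually_lt_const (EReal.coe_lt_coe_iff.1 hcr))).exists
    have hm : (b m : ℝ) / 2 ^ m ≤ CantorSpace.H s m Z_F :=
      (hm2.trans (EReal.coe_lt_coe_iff.1 hm1)).le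
    obtain ⟨Z_E, hred, hZE⟩ := CantorSpace.exists_turingReducible_turingJump (Z := Z_F)
      (CantorSpace.computable_greedyCheck ha hb J m)
    have hgreedy := CantorSpace.isGreedySubtree_of_greedyCheck hF hJ0 haw hZE
    have hgap : ∀ k, 2 ^ k * (2 : ℝ) ^ (-(s * ((J * (k + 1) : ℕ) : ℝ))) ≤
        (b k : ℝ) / 2 ^ k - (b (k + 1) : ℝ) / 2 ^ (k + 1) := by
      intro k
      refine le_trans ?_ (hbd k)
      have h1 : (2 : ℝ) ^ (-(s * ((J * (k + 1) : ℕ) : ℝ))) ≤ 2 ^ (-((4 * (k + 1) : ℕ) : ℝ)) := by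
        refine Real.rpow_le_rpow_of_exponent_le (by norm_num) ?_
        push_cast
        nlinarith
      have h2 : (2 : ℝ) ^ (-((4 * (k + 1) : ℕ) : ℝ)) = ((2 : ℝ) ^ (4 * (k + 1)))⁻¹ := by
        rw [Real.rpow_neg (by norm_num), Real.rpow_natCast]
      have h3 : (2 : ℝ) ^ (4 * (k + 1)) = 2 ^ k * (2 ^ k * (2 ^ (2 * k) * 16)) := by ring
      have h4 : (1 : ℝ) ≤ 2 ^ (2 * k) := one_le_pow₀ (by norm_num)
      calc 2 ^ k * (2 : ℝ) ^ (-(s * ((J * (k + 1) : ℕ) : ℝ)))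
          ≤ 2 ^ k * (2 ^ k * (2 ^ (2 * k) * 16))⁻¹ * (2 ^ k)⁻¹ := by
            rw [h2, h3] at h1
            refine (mul_le_mul_of_nonneg_left h1 (by positivity)).trans (le_of_eq ?_)
            field_simp
        _ = ((2 : ℝ) ^ k)⁻¹ * (2 ^ (2 * k) * 16)⁻¹ := by field_simp
        _ ≤ ((2 : ℝ) ^ k)⁻¹ / 4 := by
            rw [div_eq_mul_inv]
            refine mul_le_mul_of_nonneg_left ?_ (by positivity)
            exact inv_anti₀ (by norm_num) (by linarith)
    obtain ⟨h1, h2, h3⟩ := CantorSpace.infinite_and_tendsto_H_of_isGreedySubtree hF hgreedy hJ0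
      hgap hc hcb hbc hm
    exact ⟨Z_E, h1, h2, fun X hX n => hgreedy.subset (hX n), hred, h3⟩
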